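/- For $\kappa\in\mathbb{R}$ let $\mathbb{C}_\kappa=\{s\in\mathbb{C}:\operatorname{Re}s>\kappa\}$. A function $f$ on $\mathbb{C}_\kappa$ is called almost periodic if it is bounded and uniformly continuous on $\mathbb{C}_\kappa$ and, for every $\varepsilon>0$, there is $d>0$ such that every closed interval of length $d$ in $\mathbb{R}$ contains some $\tau$ with $|f(s+i\tau)-f(s)|\le\varepsilon$ for all $s\in\mathbb{C}_\kappa$. Let $H^\infty_{\mathrm{ap}}(\mathbb{C}_0)$ be the space of bounded analytic functions on $\mathbb{C}_0$ that are almost periodic on $\mathbb{C}_\kappa$ for some $\kappa>0$. For $f\in H^\infty_{\mathrm{ap}}(\mathbb{C}_0)$ and $\mu\ge0$ the Bohr coefficient is $$a_\mu(f)=\lim_{T\to\infty}\frac1{2T}\int_{-T}^{T}f(\sigma+it)\,e^{\mu(\sigma+it)}\,dt ,$$ where the limit exists and does not depend on $\sigma>0$, and the Bohr spectrum of $f$ is $\Lambda(f)=\{\mu\ge0: a_\mu(f)\ne0\}$. A frequency is an increasing sequence $\lambda=(\lambda_n)_{n\ge1}$ of non-negative real numbers with $\lambda_n\to\infty$, and $H^\infty_\lambda(\mathbb{C}_0)$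 is the space of all $f\in H^\infty_{\mathrm{ap}}(\mathbb{C}_0)$ with $\Lambda(f)\subseteq\{\lambda_n:n\ge1\}$. **Theorem.** Let $\lambda$ be a frequency and let $\mathcal{F}\subseteq H^\infty_\lambda(\mathbb{C}_0)$ be uniformly bounded, i.e. $\sup_{f\in\mathcal{F}}\sup_{s\in\mathbb{C}_0}|f(s)|<\infty$. Then for every sequence $(f_n)_{n\ge1}$ in $\mathcal{F}$ there exist a function $f\in H^\infty_\lambda(\mathbb{C}_0)$ and a subsequence $(f_{n_k})_{k\ge1}$ that converges to $f$ uniformly on $\mathbb{C}_\kappa$ for every $\kappa>0$. -/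

import Mathlib

open Filter Topology

/-- The open half-plane `ℂ_κ = {s : Re s > κ}`. -/
def rightHalfPlane (κ : ℝ) : Set ℂ := {s | κ < s.re}

/-- `A ⊆ ℝ` is relatively dense: for some `d > 0`, every closed interval of length `d` meets `A`. -/
def IsRelativelyDense (A : Set ℝ) : Prop :=
  ∃ d : ℝ, 0 < d ∧ ∀ a : ℝ, (Set.Icc a (a + d) ∩ A).Nonempty

/-- The set `E_f(ε)` of `ε`-translation numbers of `f` on `ℂ_κ`. -/
def translationNumbers (κ : ℝ) (f : ℂ → ℂ) (ε : ℝ) : Set ℝ :=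
  {τ | ∀ s ∈ rightHalfPlane κ, ‖f (s + Complex.I * τ) - f s‖ ≤ ε}

/-- `f` is bounded on the set `S`. -/
def IsBoundedFunOn (f : ℂ → ℂ) (S : Set ℂ) : Prop :=
  ∃ M : ℝ, ∀ s ∈ S, ‖f s‖ ≤ M

/-- `f` is almost periodic on the half-plane `ℂ_κ`. -/
structure IsAlmostPeriodicOn (κ : ℝ) (f : ℂ → ℂ) : Prop where
  bounded : IsBoundedFunOn f (rightHalfPlane κ)
  uniformContinuousOn : UniformContinuousOn f (rightHalfPlane κ)
  relativelyDense : ∀ ε : ℝ, 0 < ε → IsRelativelyDense (translationNumbers κ f ε)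

/-- The space `H^∞(ℂ_0)` of bounded analytic functions on `ℂ_0`. A function on `ℂ_0` is represented
by a function on `ℂ` whose values outside `ℂ_0` play no role. -/
def HInfty : Set (ℂ → ℂ) :=
  {f | DifferentiableOn ℂ f (rightHalfPlane 0) ∧ IsBoundedFunOn f (rightHalfPlane 0)}

/-- The space `H^∞_ap(ℂ_0)`: members of `H^∞(ℂ_0)` almost periodic on `ℂ_κ` for some `κ > 0`. -/
def HInftyAP : Set (ℂ → ℂ) :=
  {f | f ∈ HInfty ∧ ∃ κ : ℝ, 0 < κ ∧ IsAlmostPeriodicOn κ f}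

/-- The mean `(1 / 2T) ∫_{-T}^{T} f(σ + it) e^{μ(σ + it)} dt`. -/
noncomputable def bohrMean (f : ℂ → ℂ) (μ σ T : ℝ) : ℂ :=
  (1 / (2 * (T : ℂ))) *
    ∫ t in (-T)..T, f (σ + Complex.I * t) * Complex.exp (μ * (σ + Complex.I * t))

/-- The number `a` is the Bohr coefficient `a_μ(f) = lim_{T → ∞} bohrMean f μ σ T`,
the limit being the same for every `σ > 0`. -/
def HasBohrCoeff (f : ℂ → ℂ) (μ : ℝ) (a : ℂ) : Prop :=
  ∀ σ : ℝ, 0 < σ → Tendsto (bohrMean f μ σ) atTop (𝓝 a)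

/-- The Bohr spectrum `Λ(f) = {μ ≥ 0 : a_μ(f) ≠ 0}`. For `f ∈ H^∞_ap(ℂ_0)` the coefficient `a_μ(f)`
always exists, so that `a_μ(f) ≠ 0` says that `0` is not the Bohr coefficient. -/
def bohrSpectrum (f : ℂ → ℂ) : Set ℝ :=
  {μ | 0 ≤ μ ∧ ¬ HasBohrCoeff f μ 0}

/-- A frequency: an increasing sequence of non-negative real numbers with limit `∞`. -/
structure IsFrequency (lam : ℕ → ℝ) : Prop where
  nonneg : ∀ n, 0 ≤ lam n
  monotone : Monotone lam
  tendsto : Tendsto lam atTop atTop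

/-- The space `H^∞_λ(ℂ_0)`: members of `H^∞_ap(ℂ_0)` with Bohr spectrum contained in `λ`. -/
def HInftyFreq (lam : ℕ → ℝ) : Set (ℂ → ℂ) :=
  {f | f ∈ HInftyAP ∧ bohrSpectrum f ⊆ Set.range lam}

/-! Restrict the functions to a vertical line Re s = σ > 0. The restrictions are almost periodic on
ℝ, share the bound M and, by Cauchy's estimate, a Lipschitz constant, and their mean against e^{iμt}
vanishes unless μ is a value of the frequency; negative μ are excluded by pushing the contour to the
right. The class of all such functions is totally bounded in the sup norm
(`totallyBounded_apClass`). Indeed, smoothing with a kernel whose Fourier transform has compact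
support moves a Lipschitz function only slightly, and produces a trigonometric polynomial with
exponents in one finite set, since a frequency has finitely many values in a bounded interval.
Bounded sets of such polynomials are relatively compact.

That smoothing yields a trigonometric polynomial (`IsAPOnReal.exists_kernelCorr_eq_sum`) rests on
the uniqueness theorem `IsAPOnReal.eq_zero`. If all means of g vanish, they do so uniformly in the
frequency. Hence on a long circle whose length is an almost period of g, all Fourier coefficients of
g are small, and by Parseval so is the L² norm of its autocorrelation. If g ≠ 0, however, the
autocorrelation stays near the mean of |g|², which is bounded below, on a set of shifts of positive
density.

One subsequence serves the lines Re s = 1/(m+1) for all m. By Phragmén–Lindelöf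
(`norm_le_of_norm_le_on_line`), uniform convergence on a line spreads to the half-plane on its
right. The limit stays in the space (`mem_HInftyFreq_of_tendstoUniformlyOn`); here the three lines
theorem carries almost periodicity from one half-plane to all others
(`IsAlmostPeriodicOn.of_bounded`). -/

/-! ### Twisted means of almost periodic functions on the line -/

/-- The character `t ↦ e^{iμt}` of the real line. -/
noncomputable def expChar (μ t : ℝ) : ℂ := Complex.exp ((μ * t : ℝ) * Complex.I)

@[simp] lemma norm_expChar (μ t : ℝ) : ‖expChar μ t‖ = 1 := Complex.norm_exp_ofReal_mul_I _

lemma expChar_add (μ s t : ℝ) : expChar μ (s + t) = expChar μ s * expChar μ t := by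
  rw [expChar, expChar, expChar, ← Complex.exp_add]
  push_cast
  ring_nf

@[fun_prop] lemma continuous_expChar (μ : ℝ) : Continuous (expChar μ) := by
  unfold expChar
  fun_prop

lemma continuous_mul_expChar {g : ℝ → ℂ} (hg : Continuous g) (μ : ℝ) :
    Continuous fun t => g t * expChar μ t := by
  fun_prop

lemma norm_expChar_sub_le (μ ν t : ℝ) : ‖expChar μ t - expChar ν t‖ ≤ |μ - ν| * |t| := by
  have h : expChar μ t - expChar ν t = expChar ν t * (expChar (μ - ν) t - 1) := by
    rw [mul_sub, mul_one, expChar, expChar, expChar, ← Complex.exp_add]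
    push_cast
    ring_nf
  rw [h, norm_mul, norm_expChar, one_mul, expChar, mul_comm, ← abs_mul]
  exact Real.norm_exp_I_mul_ofReal_sub_one_le

/-- The mean of `t ↦ g(t) e^{iμt}` over the real line vanishes. -/
def HasZeroMean (g : ℝ → ℂ) (μ : ℝ) : Prop :=
  Tendsto (fun T : ℝ => (1 / (2 * (T : ℂ))) * ∫ t in (-T)..T, g t * expChar μ t) atTop (𝓝 0)

/-- Uniformly almost periodic functions on the real line, bounded by `B`. -/
structure IsAPOnReal (B : ℝ) (g : ℝ → ℂ) : Prop where
  norm_le : ∀ t, ‖g t‖ ≤ B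
  uniformContinuous : UniformContinuous g
  relDense : ∀ ε : ℝ, 0 < ε → IsRelativelyDense {τ | ∀ t, ‖g (t + τ) - g t‖ ≤ ε}

lemma IsAPOnReal.nonneg {B : ℝ} {g : ℝ → ℂ} (hg : IsAPOnReal B g) : 0 ≤ B :=
  (norm_nonneg _).trans (hg.norm_le 0)

lemma IsAPOnReal.continuous {B : ℝ} {g : ℝ → ℂ} (hg : IsAPOnReal B g) : Continuous g :=
  hg.uniformContinuous.continuous

lemma norm_intervalIntegral_le {F : ℝ → ℂ} {B : ℝ} (hB : ∀ t, ‖F t‖ ≤ B) (a b : ℝ) :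
    ‖∫ t in a..b, F t‖ ≤ B * |b - a| :=
  intervalIntegral.norm_integral_le_of_norm_le_const fun t _ => hB t

lemma norm_integral_shift_sub_le {F : ℝ → ℂ} (hF : Continuous F) {B : ℝ}
    (hB : ∀ t, ‖F t‖ ≤ B) (a b s : ℝ) :
    ‖(∫ t in (a + s)..(b + s), F t) - ∫ t in a..b, F t‖ ≤ 2 * B * |s| := by
  have h := intervalIntegral.integral_interval_sub_interval_comm
    (hF.intervalIntegrable (μ := MeasureTheory.volume) (a + s) (b + s))
    (hF.intervalIntegrable a b) (hF.intervalIntegrable (a + s) a)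
  rw [h]
  refine (norm_sub_le _ _).trans ?_
  have h1 := norm_intervalIntegral_le hB (a + s) a
  have h2 := norm_intervalIntegral_le hB (b + s) b
  rw [show a - (a + s) = -s by ring, abs_neg] at h1
  rw [show b - (b + s) = -s by ring, abs_neg] at h2
  linarith

/-- Translating by `τ` changes a twisted integral only by a unimodular factor. -/
lemma integral_comp_add_mul_expChar (g : ℝ → ℂ) (μ a b τ : ℝ) :
    ∫ t in (a + τ)..(b + τ), g t * expChar μ t
      = expChar μ τ * ∫ t in a..b, g (t + τ) * expChar μ t := by
  rw [← intervalIntegral.integral_comp_add_right (fun t => g t * expChar μ t),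
    ← intervalIntegral.integral_const_mul]
  congr 1
  ext t
  rw [expChar_add]
  ring

lemma norm_integral_mul_expChar_sub_le {g h : ℝ → ℂ} (hg : Continuous g) (hh : Continuous h)
    {ε : ℝ} (hε : ∀ t, ‖g t - h t‖ ≤ ε) (μ a b : ℝ) :
    ‖(∫ t in a..b, g t * expChar μ t) - ∫ t in a..b, h t * expChar μ t‖ ≤ ε * |b - a| := by
  rw [← intervalIntegral.integral_sub
    ((continuous_mul_expChar hg μ).intervalIntegrable _ _)
    ((continuous_mul_expChar hh μ).intervalIntegrable _ _)]
  refine norm_intervalIntegral_le (fun t => ?_) a b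
  rw [← sub_mul, norm_mul, norm_expChar, mul_one]
  exact hε t

/-- A translation number carries any window to within `d` of the centred window of the same length.
The translation costs a small multiple of T and a unimodular factor, the remaining shift a bounded
amount. -/
lemma IsAPOnReal.eventually_norm_integral_le {B : ℝ} {g : ℝ → ℂ} (hg : IsAPOnReal B g) {μ : ℝ}
    (h0 : HasZeroMean g μ) {ε : ℝ} (hε : 0 < ε) :
    ∀ᶠ T : ℝ in atTop, ∀ a : ℝ, ‖∫ t in a..(a + T), g t * expChar μ t‖ ≤ ε * T := by
  obtain ⟨d, hd, hdense⟩ := hg.relDense (ε / 3) (by positivity)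
  have hhalf : Tendsto (fun T : ℝ => T / 2) atTop atTop :=
    tendsto_id.atTop_div_const (by norm_num)
  have h1 := (h0.comp hhalf).eventually (Metric.ball_mem_nhds 0 (show 0 < ε / 3 by positivity))
  filter_upwards [h1, eventually_gt_atTop 0, eventually_ge_atTop (6 * B * d / ε)] with T hT hT0 hT1 a
  have hcont : Continuous fun t => g t * expChar μ t := continuous_mul_expChar hg.continuous μ
  have hnorm : ∀ t, ‖g t * expChar μ t‖ ≤ B := fun t => by simpa using hg.norm_le t
  have hmain : ‖∫ t in (-(T / 2))..(T / 2), g t * expChar μ t‖ ≤ ε / 3 * T := by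
    have : ‖(1 / (2 * ((T / 2 : ℝ) : ℂ))) * ∫ t in (-(T / 2))..(T / 2), g t * expChar μ t‖
        < ε / 3 := by simpa using hT
    have hc : (1 / (2 * ((T / 2 : ℝ) : ℂ))) = ((T⁻¹ : ℝ) : ℂ) := by
      push_cast; field_simp
    rw [hc, norm_mul, Complex.norm_real, Real.norm_of_nonneg (by positivity),
      inv_mul_lt_iff₀ hT0] at this
    linarith
  -- This choice of interval puts a + τ in [-T/2, -T/2 + d].
  obtain ⟨τ, ⟨hτ1, hτ2⟩, hτ⟩ := hdense (-a - T / 2)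
  set δ := a + τ + T / 2 with hδ
  have hshift := norm_integral_shift_sub_le hcont hnorm (-(T / 2)) (T / 2) δ
  have htr := integral_comp_add_mul_expChar g μ a (a + T) τ
  have hclose := norm_integral_mul_expChar_sub_le (g := g) (h := fun t => g (t + τ)) hg.continuous
    (hg.continuous.comp (continuous_id.add continuous_const)) (ε := ε / 3)
    (fun t => by rw [norm_sub_rev]; exact hτ t) μ a (a + T)
  have e1 : -(T / 2) + δ = a + τ := by rw [hδ]; ring
  have e2 : T / 2 + δ = a + T + τ := by rw [hδ]; ring
  rw [e1, e2] at hshift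
  have hδd : |δ| ≤ d := abs_le.2 ⟨by linarith, by linarith⟩
  have hBd : 2 * B * |δ| ≤ ε / 3 * T := by
    have : 2 * B * |δ| ≤ 2 * B * d := by
      have := hg.nonneg; gcongr
    rw [div_le_iff₀ hε] at hT1
    linarith
  have n1 : ‖∫ t in a..(a + T), g (t + τ) * expChar μ t‖
      = ‖∫ t in (a + τ)..(a + T + τ), g t * expChar μ t‖ := by
    rw [htr, norm_mul, norm_expChar, one_mul]
  rw [add_sub_cancel_left, abs_of_pos hT0] at hclose
  have n2 := norm_le_norm_add_norm_sub' (∫ t in a..(a + T), g t * expChar μ t)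
    (∫ t in a..(a + T), g (t + τ) * expChar μ t)
  have n3 := norm_le_norm_add_norm_sub' (∫ t in (a + τ)..(a + T + τ), g t * expChar μ t)
    (∫ t in (-(T / 2))..(T / 2), g t * expChar μ t)
  linarith

/-- A bound on all windows of one length gives a bound on all long windows. -/
lemma norm_integral_le_of_window {F : ℝ → ℂ} {B : ℝ} (hF : Continuous F)
    (hB : ∀ t, ‖F t‖ ≤ B) {ε T₀ : ℝ} (hT₀ : 0 < T₀)
    (hw : ∀ a, ‖∫ t in a..(a + T₀), F t‖ ≤ ε * T₀) {T : ℝ} (hT : 0 ≤ T) (a : ℝ) :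
    ‖∫ t in a..(a + T), F t‖ ≤ ε * T + (B + |ε|) * T₀ := by
  have key : ∀ n : ℕ, ‖∫ t in a..(a + n * T₀), F t‖ ≤ n * (ε * T₀) := by
    intro n
    induction n with
    | zero => simp
    | succ n ih =>
      have hadd := intervalIntegral.integral_add_adjacent_intervals
        (hF.intervalIntegrable (μ := MeasureTheory.volume) a (a + n * T₀))
        (hF.intervalIntegrable (a + n * T₀) (a + n * T₀ + T₀))
      have e : a + ((n + 1 : ℕ) : ℝ) * T₀ = a + n * T₀ + T₀ := by push_cast; ring
      rw [e, ← hadd]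
      refine (norm_add_le _ _).trans ?_
      have := hw (a + n * T₀)
      push_cast
      linarith
  set n := ⌊T / T₀⌋₊
  have h1 : n * T₀ ≤ T := by
    have := Nat.floor_le (show 0 ≤ T / T₀ by positivity)
    rwa [le_div_iff₀ hT₀] at this
  have h2 : T < (n + 1) * T₀ := by
    have := Nat.lt_floor_add_one (T / T₀)
    rwa [div_lt_iff₀ hT₀] at this
  have hadd := intervalIntegral.integral_add_adjacent_intervals
    (hF.intervalIntegrable (μ := MeasureTheory.volume) a (a + n * T₀))
    (hF.intervalIntegrable (a + n * T₀) (a + T))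
  rw [← hadd]
  refine (norm_add_le _ _).trans ?_
  have h3 := norm_intervalIntegral_le hB (a + n * T₀) (a + T)
  have h4 : |a + T - (a + n * T₀)| ≤ T₀ := abs_le.2 ⟨by linarith, by linarith⟩
  have hB0 : 0 ≤ B := (norm_nonneg _).trans (hB 0)
  have h5 : B * |a + T - (a + n * T₀)| ≤ B * T₀ := by gcongr
  have h6 : n * (ε * T₀) - ε * T ≤ |ε| * T₀ := by
    have : n * (ε * T₀) - ε * T = ε * (n * T₀ - T) := by ring
    rw [this]
    refine (le_abs_self _).trans ?_
    rw [abs_mul]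
    have : |n * T₀ - T| ≤ T₀ := abs_le.2 ⟨by linarith, by linarith⟩
    gcongr
  have := key n
  linarith

/-- The bound on twisted integrals is locally uniform in the frequency. -/
lemma IsAPOnReal.exists_nhds_norm_integral_le {B : ℝ} {g : ℝ → ℂ} (hg : IsAPOnReal B g) {μ : ℝ}
    (h0 : HasZeroMean g μ) {ε : ℝ} (hε : 0 < ε) :
    ∃ s ∈ 𝓝 μ, ∀ᶠ T : ℝ in atTop, ∀ ν ∈ s, ∀ a : ℝ,
      ‖∫ t in a..(a + T), g t * expChar ν t‖ ≤ ε * T := by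
  obtain ⟨T₀, hT₀, hpos⟩ := ((hg.eventually_norm_integral_le h0
    (show 0 < ε / 4 by positivity)).and (eventually_gt_atTop 0)).exists
  have hB := hg.nonneg
  -- On a window of length T₀ this radius alters the character by at most ε / (4(B + 1)), hence the
  -- integrand by at most ε/4; the +1 covers B = 0.
  refine ⟨Metric.closedBall μ (ε / (4 * (B + 1) * T₀)),
    Metric.closedBall_mem_nhds _ (by positivity), ?_⟩
  have hwin : ∀ ν ∈ Metric.closedBall μ (ε / (4 * (B + 1) * T₀)), ∀ a,
      ‖∫ t in a..(a + T₀), g t * expChar ν t‖ ≤ ε / 2 * T₀ := by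
    intro ν hν a
    have hga : Continuous fun t => g (t + a) := hg.continuous.comp (by fun_prop)
    -- The window is moved to start at 0, because two characters are close only near the origin.
    have htr : ∀ κ, ‖∫ t in a..(a + T₀), g t * expChar κ t‖
        = ‖∫ t in (0 : ℝ)..T₀, g (t + a) * expChar κ t‖ := by
      intro κ
      have := integral_comp_add_mul_expChar g κ 0 T₀ a
      rw [zero_add, add_comm T₀ a] at this
      rw [this, norm_mul, norm_expChar, one_mul]
    have hdiff : ‖(∫ t in (0 : ℝ)..T₀, g (t + a) * expChar ν t)
        - ∫ t in (0 : ℝ)..T₀, g (t + a) * expChar μ t‖ ≤ ε / 4 * |T₀ - 0| := by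
      rw [← intervalIntegral.integral_sub
        ((continuous_mul_expChar hga ν).intervalIntegrable _ _)
        ((continuous_mul_expChar hga μ).intervalIntegrable _ _)]
      refine intervalIntegral.norm_integral_le_of_norm_le_const fun t ht => ?_
      rw [Set.uIoc_of_le hpos.le] at ht
      rw [← mul_sub, norm_mul]
      have e1 := norm_expChar_sub_le ν μ t
      have e2 : |ν - μ| * |t| ≤ ε / (4 * (B + 1) * T₀) * T₀ := by
        rw [Metric.mem_closedBall, Real.dist_eq] at hν
        rw [abs_of_pos ht.1]
        have := ht.2
        have := ht.1.le
        gcongr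
      have e3 : ε / (4 * (B + 1) * T₀) * T₀ = ε / 4 / (B + 1) := by field_simp
      calc ‖g (t + a)‖ * ‖expChar ν t - expChar μ t‖ ≤ (B + 1) * (ε / 4 / (B + 1)) := by
            have := hg.norm_le (t + a)
            gcongr
            · linarith
            · linarith
        _ = ε / 4 := by field_simp
    have h1 := hT₀ a
    rw [htr] at h1 ⊢
    rw [sub_zero, abs_of_pos hpos] at hdiff
    have n2 := norm_le_norm_add_norm_sub' (∫ t in (0 : ℝ)..T₀, g (t + a) * expChar ν t)
      (∫ t in (0 : ℝ)..T₀, g (t + a) * expChar μ t)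
    linarith
  filter_upwards [eventually_ge_atTop 0, eventually_ge_atTop ((B + |ε / 2|) * T₀ / (ε / 2))]
    with T hT hT1 ν hν a
  have := norm_integral_le_of_window (F := fun t => g t * expChar ν t)
    (continuous_mul_expChar hg.continuous ν) (B := B) (fun t => by simpa using hg.norm_le t)
    hpos (hwin ν hν) hT a
  rw [div_le_iff₀ (by positivity)] at hT1
  linarith

/-- Riemann–Lebesgue, uniformly in the window. -/
lemma IsAPOnReal.exists_norm_integral_le_of_large {B : ℝ} {g : ℝ → ℂ} (hg : IsAPOnReal B g)
    {ε : ℝ} (hε : 0 < ε) :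
    ∃ R : ℝ, ∀ᶠ T : ℝ in atTop, ∀ ν : ℝ, R ≤ |ν| → ∀ a : ℝ,
      ‖∫ t in a..(a + T), g t * expChar ν t‖ ≤ ε * T := by
  obtain ⟨δ, hδ, hδg⟩ := Metric.uniformContinuous_iff.1 hg.uniformContinuous ε hε
  have hB := hg.nonneg
  refine ⟨2 * Real.pi / δ, ?_⟩
  filter_upwards [eventually_gt_atTop 0, eventually_ge_atTop (2 * B * δ / ε)] with T hT hT1 ν hν a
  have hR : 0 < 2 * Real.pi / δ := by positivity
  have hν0 : ν ≠ 0 := fun h => by rw [h, abs_zero] at hν; linarith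
  have hνpos : 0 < |ν| := abs_pos.2 hν0
  -- Shifting by half a period of the character flips its sign, so the integral is nearly its own
  -- negative.
  set s := Real.pi / ν with hs
  have hsδ : |s| < δ := by
    rw [hs, abs_div, abs_of_pos Real.pi_pos, div_lt_iff₀ hνpos]
    rw [div_le_iff₀ hδ] at hν
    nlinarith [Real.pi_pos]
  have hes : expChar ν s = -1 := by
    rw [expChar, hs, mul_div_cancel₀ _ hν0, Complex.exp_pi_mul_I]
  have htr := integral_comp_add_mul_expChar g ν a (a + T) s
  rw [hes] at htr
  have hshift := norm_integral_shift_sub_le (F := fun t => g t * expChar ν t)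
    (continuous_mul_expChar hg.continuous ν) (B := B) (fun t => by simpa using hg.norm_le t)
    a (a + T) s
  have hclose := norm_integral_mul_expChar_sub_le (g := g) (h := fun t => g (t + s)) hg.continuous
    (hg.continuous.comp (continuous_id.add continuous_const)) (ε := ε)
    (fun t => by
      rw [← dist_eq_norm]
      exact (hδg (by rw [Real.dist_eq]; simpa using hsδ)).le) ν a (a + T)
  rw [htr] at hshift
  rw [add_sub_cancel_left, abs_of_pos hT] at hclose
  set X := ∫ t in a..(a + T), g t * expChar ν t
  set Y := ∫ t in a..(a + T), g (t + s) * expChar ν t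
  have h2 : ‖X + X‖ ≤ ‖X - Y‖ + ‖-1 * Y - X‖ := by
    rw [show X + X = (X - Y) - (-1 * Y - X) by ring]
    exact norm_sub_le _ _
  rw [← two_mul, norm_mul] at h2
  have h3 : 2 * B * |s| ≤ 2 * B * δ := by gcongr
  rw [div_le_iff₀ hε] at hT1
  norm_num at h2 hshift hclose
  linarith

/-- If all means vanish, they vanish uniformly in frequency and position of the window. -/
lemma IsAPOnReal.eventually_norm_integral_le_uniform {B : ℝ} {g : ℝ → ℂ} (hg : IsAPOnReal B g)
    (h0 : ∀ μ, HasZeroMean g μ) {ε : ℝ} (hε : 0 < ε) :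
    ∀ᶠ T : ℝ in atTop, ∀ ν a : ℝ, ‖∫ t in a..(a + T), g t * expChar ν t‖ ≤ ε * T := by
  obtain ⟨R, hR⟩ := hg.exists_norm_integral_le_of_large hε
  have hc : ∀ᶠ T : ℝ in atTop, ∀ ν ∈ Set.Icc (-R) R, ∀ a : ℝ,
      ‖∫ t in a..(a + T), g t * expChar ν t‖ ≤ ε * T := by
    refine isCompact_Icc.induction_on (p := fun s => ∀ᶠ T : ℝ in atTop, ∀ ν ∈ s, ∀ a : ℝ,
      ‖∫ t in a..(a + T), g t * expChar ν t‖ ≤ ε * T) ?_ ?_ ?_ ?_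
    · simp
    · intro s t hst ht
      filter_upwards [ht] with T hT ν hν using hT ν (hst hν)
    · intro s t hs ht
      filter_upwards [hs, ht] with T hT hT' ν hν using hν.elim (hT ν) (hT' ν)
    · intro μ _
      obtain ⟨s, hs, h⟩ := hg.exists_nhds_norm_integral_le (h0 μ) hε
      exact ⟨s, mem_nhdsWithin_of_mem_nhds hs, h⟩
  filter_upwards [hR, hc] with T h1 h2 ν a
  by_cases h : R ≤ |ν|
  · exact h1 ν h a
  · exact h2 ν (abs_le.1 (not_le.1 h).le) a

/-! ### Autocorrelation and Parseval on a circle -/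

section Circle

open MeasureTheory AddCircle ComplexConjugate

variable {T : ℝ} [hT : Fact (0 < T)]

lemma hasSum_sq_fourierCoeff_of_bounded {w : AddCircle T → ℂ} (hw : StronglyMeasurable w) {B : ℝ}
    (hB : ∀ x, ‖w x‖ ≤ B) :
    HasSum (fun n => ‖fourierCoeff w n‖ ^ 2) (∫ x, ‖w x‖ ^ 2 ∂haarAddCircle) := by
  have hL : MemLp w 2 (haarAddCircle (T := T)) :=
    MemLp.of_bound hw.aestronglyMeasurable B (ae_of_all _ hB)
  convert hasSum_sq_fourierCoeff hL.toLp using 1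
  · simp [fourierCoeff_congr_ae hL.coeFn_toLp]
  · refine integral_congr_ae ?_
    filter_upwards [hL.coeFn_toLp] with x hx
    rw [hx]

/-- The autocorrelation `τ ↦ ∫ w(t + τ) conj(w(t)) dt` on the circle. -/
noncomputable def circleAutocorr (w : AddCircle T → ℂ) (τ : AddCircle T) : ℂ :=
  ∫ t, w (t + τ) * conj (w t) ∂haarAddCircle

lemma stronglyMeasurable_circleAutocorr {w : AddCircle T → ℂ} (hw : StronglyMeasurable w) :
    StronglyMeasurable (circleAutocorr w) := by
  refine StronglyMeasurable.integral_prod_right (f := fun τ t => w (t + τ) * conj (w t)) ?_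
  refine StronglyMeasurable.mul ?_ ?_
  · exact hw.comp_measurable (measurable_snd.add measurable_fst)
  · exact Complex.continuous_conj.comp_stronglyMeasurable (hw.comp_measurable measurable_snd)

lemma norm_circleAutocorr_le {w : AddCircle T → ℂ} {B : ℝ} (hB : ∀ x, ‖w x‖ ≤ B)
    (τ : AddCircle T) : ‖circleAutocorr w τ‖ ≤ B * B := by
  have h0 : 0 ≤ B := (norm_nonneg _).trans (hB 0)
  have := norm_integral_le_of_norm_le_const (μ := haarAddCircle (T := T)) (C := B * B)
    (f := fun t => w (t + τ) * conj (w t)) (ae_of_all _ fun t => by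
      rw [norm_mul, RCLike.norm_conj]
      exact mul_le_mul (hB _) (hB _) (norm_nonneg _) h0)
  rw [circleAutocorr]
  simpa using this

/-- Fubini and translation invariance of Haar measure. The coefficients are thus |ŵ(n)|², so that a
uniform bound on ŵ makes the autocorrelation small in L². -/
lemma fourierCoeff_circleAutocorr {w : AddCircle T → ℂ} (hw : StronglyMeasurable w) {B : ℝ}
    (hB : ∀ x, ‖w x‖ ≤ B) (n : ℤ) :
    fourierCoeff (circleAutocorr w) n = fourierCoeff w n * conj (fourierCoeff w n) := by
  have h0 : 0 ≤ B := (norm_nonneg _).trans (hB 0)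
  have hint : Integrable (Function.uncurry fun τ t => fourier (-n) τ * (w (t + τ) * conj (w t)))
      ((haarAddCircle (T := T)).prod haarAddCircle) := by
    refine Integrable.of_bound (C := B * B) ?_ (ae_of_all _ fun p => ?_)
    · refine StronglyMeasurable.aestronglyMeasurable ?_
      refine StronglyMeasurable.mul ?_ (StronglyMeasurable.mul ?_ ?_)
      · exact (fourier (-n)).continuous.stronglyMeasurable.comp_measurable measurable_fst
      · exact hw.comp_measurable (measurable_snd.add measurable_fst)
      · exact Complex.continuous_conj.comp_stronglyMeasurable (hw.comp_measurable measurable_snd)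
    · have h1 : ‖fourier (-n) p.1‖ = 1 := Circle.norm_coe _
      simp only [Function.uncurry]
      rw [norm_mul, norm_mul, RCLike.norm_conj, h1, one_mul]
      exact mul_le_mul (hB _) (hB _) (norm_nonneg _) h0
  have inner : ∀ t, ∫ τ, fourier (-n) τ * (w (t + τ) * conj (w t)) ∂haarAddCircle (T := T)
      = fourierCoeff w n * conj (fourier (-n) t * w t) := by
    intro t
    have := integral_add_left_eq_self (μ := haarAddCircle (T := T))
      (fun x => fourier (-n) x * w x) t
    rw [fourierCoeff]
    simp only [smul_eq_mul]
    rw [← this, ← integral_mul_const]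
    congr 1
    ext τ
    have hadd : ∀ x y : AddCircle T, fourier (-n) (x + y) = fourier (-n) x * fourier (-n) y := by
      intro x y
      simp only [fourier_apply, smul_add, toCircle_add, Circle.coe_mul]
    have h1 : fourier (-n) t * conj (fourier (-n) t) = 1 := by
      rw [Complex.mul_conj, Complex.normSq_eq_norm_sq]
      have h1 : ‖fourier (-n) t‖ = 1 := Circle.norm_coe _
      rw [h1]
      norm_num
    rw [hadd, map_mul]
    linear_combination (-fourier (-n) τ * w (t + τ) * conj (w t)) * h1
  calc fourierCoeff (circleAutocorr w) n
      = ∫ τ, ∫ t, fourier (-n) τ * (w (t + τ) * conj (w t)) ∂haarAddCircle ∂haarAddCircle := by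
        simp only [fourierCoeff, circleAutocorr, smul_eq_mul, integral_const_mul]
    _ = ∫ t, ∫ τ, fourier (-n) τ * (w (t + τ) * conj (w t)) ∂haarAddCircle ∂haarAddCircle :=
        integral_integral_swap hint
    _ = fourierCoeff w n * conj (fourierCoeff w n) := by
        simp only [inner]
        rw [integral_const_mul, integral_conj]
        simp [fourierCoeff]

/-- `‖w ⋆ w̃‖₂ ≤ ‖ŵ‖_∞ ‖w‖₂` on the circle. -/
lemma integral_sq_circleAutocorr_le {w : AddCircle T → ℂ} (hw : StronglyMeasurable w) {B S : ℝ}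
    (hB : ∀ x, ‖w x‖ ≤ B) (hS : ∀ n, ‖fourierCoeff w n‖ ≤ S) :
    ∫ τ, ‖circleAutocorr w τ‖ ^ 2 ∂haarAddCircle ≤ S ^ 2 * B ^ 2 := by
  have h1 := hasSum_sq_fourierCoeff_of_bounded (stronglyMeasurable_circleAutocorr hw)
    (norm_circleAutocorr_le hB)
  have h2 := (hasSum_sq_fourierCoeff_of_bounded hw hB).mul_left (S ^ 2)
  have h3 := hasSum_le (fun n => ?_) h1 h2
  · refine h3.trans (mul_le_mul_of_nonneg_left ?_ (sq_nonneg S))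
    have := norm_integral_le_of_norm_le_const (μ := haarAddCircle (T := T)) (C := B ^ 2)
      (f := fun t => ‖w t‖ ^ 2) (ae_of_all _ fun t => by
        rw [norm_pow, norm_norm]
        exact pow_le_pow_left₀ (norm_nonneg _) (hB t) 2)
    refine (le_abs_self _).trans ?_
    simpa using this
  · rw [fourierCoeff_circleAutocorr hw hB, norm_mul, RCLike.norm_conj, mul_pow]
    have := hS n
    gcongr

end Circle

/-! ### The uniqueness theorem -/

section Uniqueness

open MeasureTheory AddCircle ComplexConjugate

/-- A nonnegative function that is at least `c` on an interval of length `δ` in every cell of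
length `D` has a large integral. -/
lemma integral_ge_of_cells {F : ℝ → ℝ} {T D δ c : ℝ} (hF : ∀ t, 0 ≤ F t) (hD : 0 < D) (hδ : 0 < δ)
    (hc : 0 ≤ c) (hint : IntervalIntegrable F volume 0 T) (hT : D ≤ T)
    (hcell : ∀ a, 0 ≤ a → a + D ≤ T →
      ∃ τ, a ≤ τ ∧ τ + δ ≤ a + D ∧ ∀ x ∈ Set.Icc τ (τ + δ), c ≤ F x) :
    δ * c / (2 * D) * T ≤ ∫ t in (0 : ℝ)..T, F t := by
  have hsub : ∀ a b, 0 ≤ a → a ≤ b → b ≤ T → IntervalIntegrable F volume a b := by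
    intro a b ha hab hb
    refine hint.mono_set ?_
    rw [Set.uIcc_of_le hab, Set.uIcc_of_le (hD.le.trans hT)]
    exact Set.Icc_subset_Icc ha hb
  have key : ∀ n : ℕ, n * D ≤ T → n * (δ * c) ≤ ∫ t in (0 : ℝ)..(n * D), F t := by
    intro n
    induction n with
    | zero => simp
    | succ n ih =>
      intro hn
      push_cast at hn
      have hnD : 0 ≤ n * D := by positivity
      have e : ((n + 1 : ℕ) : ℝ) * D = n * D + D := by push_cast; ring
      obtain ⟨τ, h1, h2, h3⟩ := hcell (n * D) hnD (by linarith)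
      have i1 := hsub 0 (n * D) le_rfl hnD (by linarith)
      have i2 := hsub (n * D) τ hnD h1 (by linarith)
      have i3 := hsub τ (τ + δ) (by linarith) (by linarith) (by linarith)
      have i4 := hsub (τ + δ) (n * D + D) (by linarith) h2 (by linarith)
      rw [e, ← intervalIntegral.integral_add_adjacent_intervals i1 ((i2.trans i3).trans i4),
        ← intervalIntegral.integral_add_adjacent_intervals (i2.trans i3) i4,
        ← intervalIntegral.integral_add_adjacent_intervals i2 i3]
      have p2 : 0 ≤ ∫ t in (n * D)..τ, F t :=
        intervalIntegral.integral_nonneg h1 fun t _ => hF t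
      have p4 : 0 ≤ ∫ t in (τ + δ)..(n * D + D), F t :=
        intervalIntegral.integral_nonneg h2 fun t _ => hF t
      have p3 : ∫ _ in τ..(τ + δ), c ≤ ∫ t in τ..(τ + δ), F t :=
        intervalIntegral.integral_mono_on (by linarith) intervalIntegrable_const i3 h3
      rw [intervalIntegral.integral_const, add_sub_cancel_left, smul_eq_mul] at p3
      have := ih (by linarith)
      push_cast
      linarith
  set n := ⌊T / D⌋₊
  have hT0 : 0 ≤ T := hD.le.trans hT
  have h1 : n * D ≤ T := by
    have := Nat.floor_le (show 0 ≤ T / D by positivity)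
    rwa [le_div_iff₀ hD] at this
  have h2 : T < (n + 1) * D := by
    have := Nat.lt_floor_add_one (T / D)
    rwa [div_lt_iff₀ hD] at this
  -- At least one full cell fits, so the n cells cover at least half of [0, T]; this is the source
  -- of the factor 2 in the bound.
  have h3 : (1 : ℝ) ≤ n := by
    exact_mod_cast Nat.floor_pos.2 ((one_le_div hD).2 hT)
  have h4 : T / (2 * D) ≤ n := by
    rw [div_le_iff₀ (by positivity)]
    nlinarith
  have h5 : ∫ t in (0 : ℝ)..(n * D), F t ≤ ∫ t in (0 : ℝ)..T, F t := by
    rw [← intervalIntegral.integral_add_adjacent_intervals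
      (hsub 0 (n * D) le_rfl (by positivity) h1) (hsub (n * D) T (by positivity) h1 le_rfl)]
    have : 0 ≤ ∫ t in (n * D)..T, F t := intervalIntegral.integral_nonneg h1 fun t _ => hF t
    linarith
  have h6 : T / (2 * D) * (δ * c) ≤ n * (δ * c) := by gcongr
  have h7 : δ * c / (2 * D) * T = T / (2 * D) * (δ * c) := by ring
  linarith [key n h1]

/-- Translation numbers fill out an interval of a fixed length in every long interval. -/
lemma IsAPOnReal.exists_cells {B : ℝ} {g : ℝ → ℂ} (hg : IsAPOnReal B g) {ε : ℝ} (hε : 0 < ε) :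
    ∃ D δ : ℝ, 0 < D ∧ 0 < δ ∧ ∀ a, ∃ τ, a ≤ τ ∧ τ + δ ≤ a + D ∧
      ∀ x ∈ Set.Icc τ (τ + δ), ∀ t, ‖g (t + x) - g t‖ ≤ 2 * ε := by
  obtain ⟨d, hd, hdense⟩ := hg.relDense ε hε
  obtain ⟨δ, hδ, hδg⟩ := Metric.uniformContinuous_iff.1 hg.uniformContinuous ε hε
  refine ⟨d + δ / 2, δ / 2, by positivity, by positivity, fun a => ?_⟩
  obtain ⟨τ, ⟨h1, h2⟩, h3⟩ := hdense a
  refine ⟨τ, h1, by linarith, fun x hx t => ?_⟩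
  have e1 : ‖g (t + x) - g (t + τ)‖ ≤ ε := by
    rw [← dist_eq_norm]
    refine (hδg ?_).le
    rw [Real.dist_eq, add_sub_add_left_eq_sub, abs_of_nonneg (by linarith [hx.1])]
    linarith [hx.2]
  have e2 := h3 t
  calc ‖g (t + x) - g t‖ = ‖(g (t + x) - g (t + τ)) + (g (t + τ) - g t)‖ := by ring_nf
    _ ≤ ε + ε := norm_add_le_of_le e1 e2
    _ = 2 * ε := by ring

/-- Near t₀ + τ, for the translation numbers τ supplied by `exists_cells`, the modulus of g is at
least half of its value at t₀. -/
lemma IsAPOnReal.exists_integral_sq_ge {B : ℝ} {g : ℝ → ℂ} (hg : IsAPOnReal B g) {t₀ : ℝ}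
    (ht₀ : g t₀ ≠ 0) :
    ∃ c > 0, ∀ᶠ T : ℝ in atTop, c * T ≤ ∫ t in (0 : ℝ)..T, ‖g t‖ ^ 2 := by
  have hρ : 0 < ‖g t₀‖ := norm_pos_iff.2 ht₀
  obtain ⟨D, δ, hD, hδ, hcell⟩ := hg.exists_cells (show 0 < ‖g t₀‖ / 4 by positivity)
  refine ⟨δ * (‖g t₀‖ / 2) ^ 2 / (2 * D), by positivity, ?_⟩
  filter_upwards [eventually_ge_atTop D] with T hT
  refine integral_ge_of_cells (fun t => by positivity) hD hδ (by positivity)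
    ((hg.continuous.norm.pow 2).intervalIntegrable _ _) hT fun a _ _ => ?_
  obtain ⟨τ, h1, h2, h3⟩ := hcell (a - t₀)
  refine ⟨τ + t₀, by linarith, by linarith, fun x hx => ?_⟩
  have h4 := h3 (x - t₀) ⟨by linarith [hx.1], by linarith [hx.2]⟩ t₀
  rw [add_sub_cancel] at h4
  have h5 : ‖g t₀‖ / 2 ≤ ‖g x‖ := by
    have := norm_le_norm_add_norm_sub (g x) (g t₀)
    linarith
  gcongr

lemma circle_integral_eq {T : ℝ} [hT : Fact (0 < T)] {E : Type*} [NormedAddCommGroup E]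
    [NormedSpace ℝ E] (f : AddCircle T → E) :
    ∫ x, f x ∂haarAddCircle = T⁻¹ • ∫ t in (0 : ℝ)..T, f t := by
  rw [integral_haarAddCircle, ← AddCircle.intervalIntegral_preimage T 0, zero_add]

lemma norm_liftIco_le {g : ℝ → ℂ} {B : ℝ} (hB : ∀ t, ‖g t‖ ≤ B) {T : ℝ} [Fact (0 < T)]
    (x : AddCircle T) : ‖liftIco T 0 g x‖ ≤ B :=
  hB _

lemma stronglyMeasurable_liftIco {g : ℝ → ℂ} (hg : Continuous g) {T : ℝ} [Fact (0 < T)] :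
    StronglyMeasurable (liftIco T 0 g) :=
  (hg.measurable.comp
    (measurable_subtype_coe.comp (measurableEquivIco T 0).measurable)).stronglyMeasurable

/-- Autocorrelation of the restriction of an almost periodic function to a period which is itself
a translation number. -/
lemma IsAPOnReal.norm_circleAutocorr_sub_le {B : ℝ} {g : ℝ → ℂ} (hg : IsAPOnReal B g)
    {T : ℝ} [hT : Fact (0 < T)] {ε : ℝ} (hTε : ∀ t, ‖g (t + T) - g t‖ ≤ ε) {x : ℝ}
    (hx : x ∈ Set.Icc 0 T) (hxε : ∀ t, ‖g (t + x) - g t‖ ≤ 2 * ε) :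
    ‖circleAutocorr (liftIco T 0 g) (x : AddCircle T)
      - ((T⁻¹ * ∫ t in (0 : ℝ)..T, ‖g t‖ ^ 2 : ℝ) : ℂ)‖ ≤ 3 * ε * B := by
  have hT0 : 0 < T := hT.out
  have hε : 0 ≤ ε := (norm_nonneg _).trans (hTε 0)
  have hsq : ((T⁻¹ * ∫ t in (0 : ℝ)..T, ‖g t‖ ^ 2 : ℝ) : ℂ)
      = ∫ t : AddCircle T, liftIco T 0 g t * conj (liftIco T 0 g t) ∂haarAddCircle := by
    rw [circle_integral_eq, Complex.ofReal_mul, ← intervalIntegral.integral_ofReal,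
      Complex.real_smul]
    congr 1
    rw [intervalIntegral.integral_of_le hT0.le, intervalIntegral.integral_of_le hT0.le,
      ← integral_Ico_eq_integral_Ioc, ← integral_Ico_eq_integral_Ioc]
    refine setIntegral_congr_fun measurableSet_Ico fun t ht => ?_
    rw [liftIco_zero_coe_apply ht, Complex.mul_conj, Complex.normSq_eq_norm_sq]
  have hbound := norm_liftIco_le hg.norm_le (T := T)
  have hmeas := stronglyMeasurable_liftIco hg.continuous (T := T)
  have hmeas' : StronglyMeasurable fun t => conj (liftIco T 0 g t) :=
    Complex.continuous_conj.comp_stronglyMeasurable hmeas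
  have i1 : Integrable (fun t => liftIco T 0 g (t + x) * conj (liftIco T 0 g t))
      (haarAddCircle (T := T)) := by
    refine Integrable.of_bound (C := B * B)
      ((hmeas.comp_measurable (measurable_add_const _)).mul hmeas').aestronglyMeasurable
      (ae_of_all _ fun t => ?_)
    rw [norm_mul, RCLike.norm_conj]
    exact mul_le_mul (hbound _) (hbound _) (norm_nonneg _) hg.nonneg
  have i2 : Integrable (fun t => liftIco T 0 g t * conj (liftIco T 0 g t))
      (haarAddCircle (T := T)) := by
    refine Integrable.of_bound (C := B * B) (hmeas.mul hmeas').aestronglyMeasurable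
      (ae_of_all _ fun t => ?_)
    rw [norm_mul, RCLike.norm_conj]
    exact mul_le_mul (hbound _) (hbound _) (norm_nonneg _) hg.nonneg
  rw [hsq, circleAutocorr, ← integral_sub i1 i2]
  refine (norm_integral_le_of_norm_le_const (C := 3 * ε * B) (ae_of_all _ fun y => ?_)).trans_eq
    (by simp)
  rw [← sub_mul, norm_mul, RCLike.norm_conj]
  refine mul_le_mul ?_ (hbound y) (norm_nonneg _) (by positivity)
  obtain ⟨t, ht, rfl⟩ : ∃ t ∈ Set.Ico 0 T, (t : AddCircle T) = y := by
    have h := (equivIco T 0 y).2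
    exact ⟨_, ⟨h.1, by simpa using h.2⟩, coe_equivIco⟩
  rw [liftIco_zero_coe_apply ht, ← AddCircle.coe_add]
  by_cases hlt : t + x < T
  · rw [liftIco_zero_coe_apply ⟨by linarith [ht.1, hx.1], hlt⟩]
    linarith [hxε t]
  -- When t + x leaves the period it wraps to t + x - T; since T is itself an ε-translation number,
  -- this adds only ε to the 2ε coming from x.
  · have e : ((t + x : ℝ) : AddCircle T) = ((t + x - T : ℝ) : AddCircle T) := by
      rw [AddCircle.coe_sub, AddCircle.coe_period, sub_zero]
    rw [e, liftIco_zero_coe_apply ⟨by linarith, by linarith [ht.2, hx.2]⟩]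
    have h1 := hTε (t + x - T)
    rw [sub_add_cancel, norm_sub_rev] at h1
    calc ‖g (t + x - T) - g t‖
        = ‖(g (t + x - T) - g (t + x)) + (g (t + x) - g t)‖ := by ring_nf
      _ ≤ ε + 2 * ε := norm_add_le_of_le h1 (hxε t)
      _ = 3 * ε := by ring

/-- The coefficients are twisted means at the frequencies -2πn/T, which vary with T; hence the need
for a bound uniform in ν. -/
lemma norm_fourierCoeff_liftIco_le {g : ℝ → ℂ} {T : ℝ} [hT : Fact (0 < T)] {η : ℝ}
    (h : ∀ ν : ℝ, ‖∫ t in (0 : ℝ)..T, g t * expChar ν t‖ ≤ η * T) (n : ℤ) :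
    ‖fourierCoeff (liftIco T 0 g) n‖ ≤ η := by
  have hT0 : 0 < T := hT.out
  rw [fourierCoeff_liftIco_eq, fourierCoeffOn_eq_integral]
  have e : ∫ x in (0 : ℝ)..(0 + T), fourier (-n) (x : AddCircle (0 + T - 0)) • g x
      = ∫ t in (0 : ℝ)..T, g t * expChar (-(2 * Real.pi * n / T)) t := by
    rw [zero_add]
    congr 1
    ext x
    rw [fourier_coe_apply, smul_eq_mul, mul_comm, expChar]
    congr 2
    push_cast
    ring
  rw [e, norm_smul]
  have := h (-(2 * Real.pi * n / T))
  rw [zero_add, sub_zero, Real.norm_of_nonneg (by positivity), one_div, inv_mul_le_iff₀ hT0]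
  linarith

/-- **Uniqueness theorem** for almost periodic functions. -/
theorem IsAPOnReal.eq_zero {B : ℝ} {g : ℝ → ℂ} (hg : IsAPOnReal B g)
    (h0 : ∀ μ, HasZeroMean g μ) (t₀ : ℝ) : g t₀ = 0 := by
  by_contra hne
  obtain ⟨c, hc, hcT⟩ := hg.exists_integral_sq_ge hne
  have hB := hg.nonneg
  -- With 3εB ≤ c/2, an autocorrelation within 3εB of a mean square that is at least c has modulus
  -- at least c/2.
  set ε := c / (6 * (B + 1)) with hε
  have hε0 : 0 < ε := by positivity
  have hεB : 3 * ε * B ≤ c / 2 := by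
    have : 3 * ε * (B + 1) = c / 2 := by rw [hε]; field_simp; ring
    nlinarith
  obtain ⟨D, δ, hD, hδ, hcell⟩ := hg.exists_cells hε0
  -- The lower bound per unit length that `integral_ge_of_cells` gives for the squared
  -- autocorrelation; η is then taken so small that Parseval contradicts it.
  set c₂ := δ * (c / 2) ^ 2 / (2 * D) with hc₂
  have hc₂0 : 0 < c₂ := by positivity
  obtain ⟨η, hη0, hη⟩ : ∃ η > 0, η ^ 2 * B ^ 2 < c₂ := by
    have hcont : Tendsto (fun η : ℝ => η ^ 2 * B ^ 2) (𝓝[>] 0) (𝓝 (0 ^ 2 * B ^ 2)) :=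
      ((continuous_id.pow 2).mul continuous_const).continuousAt.tendsto.mono_left
        nhdsWithin_le_nhds
    have := hcont.eventually_lt_const (show (0 : ℝ) ^ 2 * B ^ 2 < c₂ by simpa using hc₂0)
    obtain ⟨η, h1, h2⟩ := (this.and self_mem_nhdsWithin).exists
    exact ⟨η, h2, h1⟩
  obtain ⟨T₁, hT₁⟩ := eventually_atTop.1 ((hcT.and
    (hg.eventually_norm_integral_le_uniform h0 hη0)).and
      ((eventually_ge_atTop D).and (eventually_gt_atTop 0)))
  obtain ⟨d, _, hdense⟩ := hg.relDense ε hε0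
  -- The period is both beyond T₁ and an ε-translation number.
  obtain ⟨T, ⟨hTT, _⟩, hTε⟩ := hdense T₁
  obtain ⟨⟨hsq, hsmall⟩, hDT, hT0⟩ := hT₁ T hTT
  have : Fact (0 < T) := ⟨hT0⟩
  have hmeas := stronglyMeasurable_liftIco hg.continuous (T := T)
  have hbound := norm_liftIco_le hg.norm_le (T := T)
  have hupper := integral_sq_circleAutocorr_le hmeas hbound (norm_fourierCoeff_liftIco_le (η := η)
    fun ν => by simpa using hsmall ν 0)
  rw [circle_integral_eq, smul_eq_mul] at hupper
  have hlower := integral_ge_of_cells (T := T) (D := D) (δ := δ) (c := (c / 2) ^ 2)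
    (F := fun t => ‖circleAutocorr (liftIco T 0 g) (t : AddCircle T)‖ ^ 2)
    (fun t => by positivity) hD hδ (by positivity) ?_ hDT ?_
  · rw [inv_mul_le_iff₀ hT0] at hupper
    have : T * (η ^ 2 * B ^ 2) < T * c₂ := by gcongr
    linarith
  · have hm : Measurable fun t : ℝ => ‖circleAutocorr (liftIco T 0 g) (t : AddCircle T)‖ ^ 2 :=
      (((stronglyMeasurable_circleAutocorr hmeas).measurable.comp
        AddCircle.measurable_mk').norm).pow_const 2
    refine (intervalIntegrable_const (c := (B * B) ^ 2)).mono_fun hm.aestronglyMeasurable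
      (ae_of_all _ fun t => ?_)
    have := norm_circleAutocorr_le hbound (t : AddCircle T)
    simp only [norm_pow, norm_norm]
    rw [Real.norm_of_nonneg (mul_self_nonneg B)]
    gcongr
  · intro a ha haT
    obtain ⟨τ, h1, h2, h3⟩ := hcell a
    refine ⟨τ, h1, h2, fun x hx => ?_⟩
    have hxT : x ∈ Set.Icc 0 T := ⟨by linarith [hx.1], by linarith [hx.2]⟩
    have h4 := hg.norm_circleAutocorr_sub_le hTε hxT (h3 x hx)
    set m := T⁻¹ * ∫ t in (0 : ℝ)..T, ‖g t‖ ^ 2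
    have h5 : c ≤ m := by
      rw [le_inv_mul_iff₀ hT0]
      linarith
    have h6 : ‖(m : ℂ)‖ = m := by
      rw [Complex.norm_real, Real.norm_of_nonneg (hc.le.trans h5)]
    have h7 := norm_le_norm_add_norm_sub
      (circleAutocorr (liftIco T 0 g) (x : AddCircle T)) (m : ℂ)
    have h8 : c / 2 ≤ ‖circleAutocorr (liftIco T 0 g) (x : AddCircle T)‖ := by linarith
    gcongr

end Uniqueness

/-! ### Correlation with an integrable kernel -/

section Kernel

open MeasureTheory

/-- The correlation `t ↦ ∫ F(t + u) K(u) du` of a bounded function with a kernel. -/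
noncomputable def kernelCorr (F K : ℝ → ℂ) (t : ℝ) : ℂ := ∫ u, F (t + u) * K u

variable {F K : ℝ → ℂ} {B : ℝ}

lemma integrable_kernelCorr (hF : Continuous F) (hB : ∀ t, ‖F t‖ ≤ B) (hK : Integrable K) (t : ℝ) :
    Integrable fun u => F (t + u) * K u :=
  hK.bdd_mul (hF.comp (by fun_prop)).aestronglyMeasurable (ae_of_all _ fun u => hB (t + u))

lemma norm_integral_mul_kernel_le {G : ℝ → ℂ} {C : ℝ} (hC : ∀ u, ‖G u‖ ≤ C) (hK : Integrable K) :
    ‖∫ u, G u * K u‖ ≤ C * ∫ u, ‖K u‖ := by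
  rw [← integral_const_mul]
  refine norm_integral_le_of_norm_le (hK.norm.const_mul C) (ae_of_all _ fun u => ?_)
  rw [norm_mul]
  exact mul_le_mul_of_nonneg_right (hC u) (norm_nonneg _)

lemma norm_kernelCorr_sub_le (hF : Continuous F) (hB : ∀ t, ‖F t‖ ≤ B) (hK : Integrable K)
    {s t ε : ℝ} (h : ∀ u, ‖F (t + u) - F (s + u)‖ ≤ ε) :
    ‖kernelCorr F K t - kernelCorr F K s‖ ≤ ε * ∫ u, ‖K u‖ := by
  rw [kernelCorr, kernelCorr, ← integral_sub (integrable_kernelCorr hF hB hK t)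
    (integrable_kernelCorr hF hB hK s)]
  simp_rw [← sub_mul]
  exact norm_integral_mul_kernel_le h hK

lemma IsAPOnReal.kernelCorr (hF : IsAPOnReal B F) (hK : Integrable K) :
    IsAPOnReal (B * ∫ u, ‖K u‖) (kernelCorr F K) := by
  have hI : 0 ≤ ∫ u, ‖K u‖ := integral_nonneg fun u => norm_nonneg _
  have hε' : ∀ ε > 0, 0 < ε / ((∫ u, ‖K u‖) + 1) := fun ε hε => by positivity
  have hle : ∀ ε > 0, ε / ((∫ u, ‖K u‖) + 1) * ∫ u, ‖K u‖ < ε := fun ε hε => by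
    rw [div_mul_eq_mul_div, div_lt_iff₀ (by positivity)]
    linarith
  refine ⟨fun t => norm_integral_mul_kernel_le (fun u => hF.norm_le _) hK, ?_, fun ε hε => ?_⟩
  · refine Metric.uniformContinuous_iff.2 fun ε hε => ?_
    obtain ⟨δ, hδ, h⟩ := Metric.uniformContinuous_iff.1 hF.uniformContinuous _ (hε' ε hε)
    refine ⟨δ, hδ, fun {a b} hab => ?_⟩
    rw [dist_eq_norm]
    refine (norm_kernelCorr_sub_le hF.continuous hF.norm_le hK fun u => ?_).trans_lt (hle ε hε)
    rw [← dist_eq_norm]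
    exact (h (by simpa using hab)).le
  · obtain ⟨d, hd, h⟩ := hF.relDense _ (hε' ε hε)
    refine ⟨d, hd, fun a => (h a).mono (Set.inter_subset_inter_right _ fun τ hτ t => ?_)⟩
    refine (norm_kernelCorr_sub_le hF.continuous hF.norm_le hK fun u => ?_).trans (hle ε hε).le
    rw [add_right_comm]
    exact hτ _

lemma intervalIntegral_kernelCorr (hF : Continuous F) (hB : ∀ t, ‖F t‖ ≤ B) (hK : Integrable K)
    (μ : ℝ) {T : ℝ} (hT : 0 ≤ T) :
    ∫ t in (-T)..T, kernelCorr F K t * expChar μ t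
      = ∫ u, (expChar (-μ) u * ∫ t in (-T + u)..(T + u), F t * expChar μ t) * K u := by
  have hle : -T ≤ T := by linarith
  have hint : Integrable (Function.uncurry fun t u => F (t + u) * K u * expChar μ t)
      ((volume.restrict (Set.Ioc (-T) T)).prod volume) := by
    have h1 : Integrable (fun p : ℝ × ℝ => (1 : ℂ) * K p.2)
        ((volume.restrict (Set.Ioc (-T) T)).prod volume) :=
      (integrable_const (1 : ℂ)).mul_prod hK
    have h2 := h1.bdd_mul (c := B) (f := fun p : ℝ × ℝ => F (p.1 + p.2) * expChar μ p.1)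
      (by
        have : Continuous fun p : ℝ × ℝ => F (p.1 + p.2) * expChar μ p.1 := by fun_prop
        exact this.aestronglyMeasurable)
      (ae_of_all _ fun p => by simpa using hB (p.1 + p.2))
    refine h2.congr (ae_of_all _ fun p => ?_)
    simp only [Function.uncurry]
    ring
  calc ∫ t in (-T)..T, kernelCorr F K t * expChar μ t
      = ∫ t in Set.Ioc (-T) T, ∫ u, F (t + u) * K u * expChar μ t := by
        rw [intervalIntegral.integral_of_le hle]
        simp only [kernelCorr, integral_mul_const]
    _ = ∫ u, ∫ t in Set.Ioc (-T) T, F (t + u) * K u * expChar μ t := integral_integral_swap hint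
    _ = _ := by
        congr 1
        ext u
        rw [integral_comp_add_mul_expChar, ← mul_assoc, ← intervalIntegral.integral_of_le hle,
          show expChar (-μ) u * expChar μ u = 1 by
            rw [expChar, expChar, ← Complex.exp_add]
            push_cast
            ring_nf
            exact Complex.exp_zero, one_mul, ← intervalIntegral.integral_mul_const]
        congr 1
        ext t
        ring

/-- The mean of `kernelCorr F K` vanishes where that of `F` or the transform of `K` does. -/
lemma HasZeroMean.kernelCorr (hF : Continuous F) (hB : ∀ t, ‖F t‖ ≤ B) (hK : Integrable K)
    (hK1 : Integrable fun u => |u| * ‖K u‖) {μ : ℝ}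
    (h : HasZeroMean F μ ∨ ∫ u, expChar (-μ) u * K u = 0) : HasZeroMean (kernelCorr F K) μ := by
  have hB0 : 0 ≤ B := (norm_nonneg _).trans (hB 0)
  set m : ℝ → ℂ := fun T => (1 / (2 * (T : ℂ))) * ∫ t in (-T)..T, F t * expChar μ t with hm
  -- Up to a remainder, the mean of the correlation is the mean of F times the transform of K, and
  -- one of these factors tends to zero or is zero.
  have hmK : Tendsto (fun T => m T * ∫ u, expChar (-μ) u * K u) atTop (𝓝 0) := by
    rcases h with h | h
    · have := Tendsto.mul_const (∫ u, expChar (-μ) u * K u) h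
      rwa [zero_mul] at this
    · simp [h]
  have herr : Tendsto (fun T : ℝ => T⁻¹ * (B * ∫ u, |u| * ‖K u‖)) atTop (𝓝 0) := by
    simpa using tendsto_inv_atTop_zero.mul_const (B * ∫ u, |u| * ‖K u‖)
  have hsum := hmK.norm.add herr
  rw [norm_zero, add_zero] at hsum
  refine squeeze_zero_norm' ?_ hsum
  filter_upwards [eventually_gt_atTop 0] with T hT
  rw [intervalIntegral_kernelCorr hF hB hK μ hT.le]
  set J := ∫ t in (-T)..T, F t * expChar μ t with hJ
  set W : ℝ → ℂ := fun u => ∫ t in (-T + u)..(T + u), F t * expChar μ t with hW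
  have hcont := continuous_mul_expChar hF μ
  have hnorm : ∀ t, ‖F t * expChar μ t‖ ≤ B := fun t => by simpa using hB t
  have hWcont : Continuous W := by
    have : W = fun u => (∫ t in (0 : ℝ)..(T + u), F t * expChar μ t)
        - ∫ t in (0 : ℝ)..(-T + u), F t * expChar μ t := by
      ext u
      rw [hW]
      exact (intervalIntegral.integral_interval_sub_left (hcont.intervalIntegrable _ _)
        (hcont.intervalIntegrable _ _)).symm
    rw [this]
    have hprim := intervalIntegral.continuous_primitive (μ := volume)
      (fun a b => hcont.intervalIntegrable a b) 0
    exact (hprim.comp (by fun_prop)).sub (hprim.comp (by fun_prop))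
  have i1 : Integrable fun u => (expChar (-μ) u * W u) * K u := by
    refine hK.bdd_mul (c := B * |T - -T|)
      ((continuous_expChar _).mul hWcont).aestronglyMeasurable (ae_of_all _ fun u => ?_)
    rw [norm_mul, norm_expChar, one_mul]
    have := norm_intervalIntegral_le hnorm (-T + u) (T + u)
    rwa [show T + u - (-T + u) = T - -T by ring] at this
  have i2 : Integrable fun u => (expChar (-μ) u * K u) :=
    hK.bdd_mul (c := 1) (continuous_expChar _).aestronglyMeasurable
      (ae_of_all _ fun u => (norm_expChar _ _).le)
  have hsplit : ∫ u, (expChar (-μ) u * W u) * K u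
      = J * (∫ u, expChar (-μ) u * K u) + ∫ u, (expChar (-μ) u * (W u - J)) * K u := by
    rw [← integral_const_mul, ← integral_add (i2.const_mul J)]
    · congr 1
      ext u
      ring
    · refine (i1.sub (i2.const_mul J)).congr (ae_of_all _ fun u => ?_)
      simp only [Pi.sub_apply]
      ring
  -- Moving the window by u costs at most 2B|u|, which is why K needs a finite first moment.
  have hrem : ‖∫ u, (expChar (-μ) u * (W u - J)) * K u‖ ≤ 2 * B * ∫ u, |u| * ‖K u‖ := by
    rw [← integral_const_mul]
    refine norm_integral_le_of_norm_le (hK1.const_mul _) (ae_of_all _ fun u => ?_)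
    rw [norm_mul, norm_mul, norm_expChar, one_mul, ← mul_assoc]
    exact mul_le_mul_of_nonneg_right (norm_integral_shift_sub_le hcont hnorm (-T) T u)
      (norm_nonneg _)
  rw [hsplit, mul_add]
  refine norm_add_le_of_le (le_of_eq ?_) ?_
  · rw [hm, mul_assoc]
  · have : ‖(1 / (2 * (T : ℂ)))‖ = (2 * T)⁻¹ := by
      rw [norm_div, norm_mul, Complex.norm_real, Real.norm_of_nonneg hT.le]
      norm_num
    rw [norm_mul, this]
    calc (2 * T)⁻¹ * ‖∫ u, (expChar (-μ) u * (W u - J)) * K u‖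
        ≤ (2 * T)⁻¹ * (2 * B * ∫ u, |u| * ‖K u‖) := by gcongr
      _ = T⁻¹ * (B * ∫ u, |u| * ‖K u‖) := by field_simp

lemma norm_kernelCorr_sub_self_le (hF : Continuous F) (hB : ∀ t, ‖F t‖ ≤ B) {L : ℝ}
    (hL : ∀ s t, ‖F s - F t‖ ≤ L * |s - t|) (hK : Integrable K)
    (hK1 : Integrable fun u => |u| * ‖K u‖) (hone : ∫ u, K u = 1) (t : ℝ) :
    ‖kernelCorr F K t - F t‖ ≤ L * ∫ u, |u| * ‖K u‖ := by
  have h : kernelCorr F K t - F t = ∫ u, (F (t + u) - F t) * K u := by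
    simp_rw [sub_mul]
    rw [integral_sub (integrable_kernelCorr hF hB hK t) (hK.const_mul _), integral_const_mul, hone,
      mul_one, kernelCorr]
  rw [h, ← integral_const_mul]
  refine norm_integral_le_of_norm_le (hK1.const_mul _) (ae_of_all _ fun u => ?_)
  rw [norm_mul, ← mul_assoc]
  refine mul_le_mul_of_nonneg_right ?_ (norm_nonneg _)
  simpa using hL (t + u) t

end Kernel

/-! ### Band-limited kernels and trigonometric polynomials -/

section Schwartz

open MeasureTheory SchwartzMap FourierTransform
open scoped ContDiff

variable {F : ℝ → ℂ} {B : ℝ}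

lemma integrable_abs_mul_norm_schwartz (K : 𝓢(ℝ, ℂ)) : Integrable fun u => |u| * ‖K u‖ := by
  simpa using K.integrable_pow_mul volume 1

/-- Fourier inversion, with the transform normalised by e^{-2πiuv}. A frequency μ of F is therefore
tested by ψ at the point -μ/(2π). -/
lemma integral_expChar_mul_fourier (ψ : 𝓢(ℝ, ℂ)) (μ : ℝ) :
    ∫ u, expChar μ u * 𝓕 ψ u = ψ (μ / (2 * Real.pi)) := by
  have h : (𝓕⁻ (𝓕 ψ)) (μ / (2 * Real.pi)) = ψ (μ / (2 * Real.pi)) := by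
    rw [FourierTransform.fourierInv_fourier_eq]
  rw [← h, SchwartzMap.fourierInv_coe, Real.fourierInv_eq']
  congr 1
  ext u
  rw [smul_eq_mul, expChar]
  congr 3
  simp only [RCLike.inner_apply, conj_trivial]
  field_simp

/-- The spectrum of an almost periodic function determines where a kernel has to vanish
in order to annihilate it. -/
lemma IsAPOnReal.kernelCorr_fourier_eq_zero (hF : IsAPOnReal B F) {Λ : Set ℝ}
    (hΛ : ∀ μ ∉ Λ, HasZeroMean F μ) (ψ : 𝓢(ℝ, ℂ)) (hψ : ∀ μ ∈ Λ, ψ (-μ / (2 * Real.pi)) = 0)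
    (t : ℝ) : _root_.kernelCorr F (𝓕 ψ : 𝓢(ℝ, ℂ)) t = 0 := by
  refine (hF.kernelCorr (𝓕 ψ : 𝓢(ℝ, ℂ)).integrable).eq_zero (fun μ => ?_) t
  refine HasZeroMean.kernelCorr hF.continuous hF.norm_le (𝓕 ψ : 𝓢(ℝ, ℂ)).integrable
    (integrable_abs_mul_norm_schwartz _) ?_
  by_cases hμ : μ ∈ Λ
  · right
    rw [integral_expChar_mul_fourier, hψ μ hμ]
  · exact Or.inl (hΛ μ hμ)

/-- Every bounded part of `Λ` is finite. -/
def IsLocallyFiniteSet (Λ : Set ℝ) : Prop := ∀ R : ℝ, (Λ ∩ Set.Icc (-R) R).Finite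

lemma IsLocallyFiniteSet.exists_schwartz {Λ : Set ℝ} (hΛ : IsLocallyFiniteSet Λ) (μ : ℝ) :
    ∃ φ : 𝓢(ℝ, ℂ), φ (-μ / (2 * Real.pi)) = 1 ∧
      ∀ ν ∈ Λ, ν ≠ μ → φ (-ν / (2 * Real.pi)) = 0 := by
  -- The other points of Λ near μ form a finite, hence closed, set, so a bump function at μ can
  -- avoid them; Λ outside the interval is avoided anyway.
  set A : Set ℝ := (Λ ∩ Set.Icc (-(|μ| + 1)) (|μ| + 1)) \ {μ}
  have hA : A.Finite := (hΛ _).subset Set.sdiff_subset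
  set U : Set ℝ := Set.Ioo (-(|μ| + 1)) (|μ| + 1) ∩ Aᶜ
  have hU : IsOpen U := isOpen_Ioo.inter hA.isClosed.isOpen_compl
  have hμU : μ ∈ U := by
    refine ⟨abs_lt.1 (lt_add_one _), fun h => h.2 rfl⟩
  have hpi := Real.pi_pos
  have hs : (fun v : ℝ => -(2 * Real.pi) * v) ⁻¹' U ∈ 𝓝 (-μ / (2 * Real.pi)) := by
    refine (hU.preimage (by fun_prop)).mem_nhds ?_
    rw [Set.mem_preimage]
    convert hμU using 1
    field_simp
  obtain ⟨f, h1, h2, h3, -, h5⟩ := exists_contDiff_tsupport_subset (n := ⊤) hs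
  have h2' : HasCompactSupport fun v => (f v : ℂ) := h2.comp_left (g := Complex.ofReal) rfl
  have h3' : ContDiff ℝ ∞ fun v => (f v : ℂ) := Complex.ofRealCLM.contDiff.comp h3
  have hval : ∀ v, h2'.toSchwartzMap h3' v = f v := fun _ => rfl
  refine ⟨h2'.toSchwartzMap h3', by simp [hval, h5], fun ν hν hne => ?_⟩
  rw [hval, Complex.ofReal_eq_zero]
  by_contra hf
  have := h1 (subset_tsupport _ (Function.mem_support.2 hf))
  rw [Set.mem_preimage, show -(2 * Real.pi) * (-ν / (2 * Real.pi)) = ν by field_simp] at this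
  exact this.2 ⟨⟨hν, Set.Ioo_subset_Icc_self this.1⟩, hne⟩

/-- Modulating a compactly supported kernel translates its Fourier transform. -/
lemma exists_schwartz_modulation (ψ : 𝓢(ℝ, ℂ)) (hψ : HasCompactSupport ψ) (t : ℝ) :
    ∃ χ : 𝓢(ℝ, ℂ), (∀ v, χ v = expChar (2 * Real.pi * t) v * ψ v) ∧
      ∀ u, 𝓕 χ u = 𝓕 ψ (u - t) := by
  have hsupp : HasCompactSupport fun v => expChar (2 * Real.pi * t) v * ψ v := hψ.mul_left
  have hexp : ContDiff ℝ ∞ (expChar (2 * Real.pi * t)) := by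
    unfold expChar
    have : ContDiff ℝ ∞ fun x : ℝ => ((2 * Real.pi * t * x : ℝ) : ℂ) :=
      Complex.ofRealCLM.contDiff.comp (contDiff_const.mul contDiff_id)
    exact (this.mul contDiff_const).cexp
  refine ⟨hsupp.toSchwartzMap (hexp.mul (ψ.smooth ⊤)), fun v => rfl, fun u => ?_⟩
  rw [SchwartzMap.fourier_coe, SchwartzMap.fourier_coe, Real.fourier_eq', Real.fourier_eq']
  congr 1
  ext v
  rw [HasCompactSupport.toSchwartzMap_toFun, smul_eq_mul, smul_eq_mul, ← mul_assoc, expChar,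
    ← Complex.exp_add]
  congr 2
  simp only [RCLike.inner_apply, conj_trivial]
  push_cast
  ring

lemma kernelCorr_eq_of_shift {K K' : ℝ → ℂ} {t : ℝ} (h : ∀ u, K' u = K (u - t)) :
    kernelCorr F K t = kernelCorr F K' 0 := by
  rw [kernelCorr, kernelCorr,
    ← integral_add_right_eq_self (fun u => F (0 + u) * K' u) t]
  congr 1
  ext u
  rw [h, zero_add, add_sub_cancel_right, add_comm]

/-- For a kernel with compactly supported transform, the correlation with an almost periodic
function with locally finite spectrum is a trigonometric polynomial. -/
lemma IsAPOnReal.exists_kernelCorr_eq_sum (hF : IsAPOnReal B F) {Λ : Set ℝ}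
    (hfin : IsLocallyFiniteSet Λ) (hΛ : ∀ μ ∉ Λ, HasZeroMean F μ) (ψ : 𝓢(ℝ, ℂ)) {R : ℝ}
    (hcpt : HasCompactSupport ψ)
    (hψ : ∀ μ : ℝ, R < |μ| → ψ (-μ / (2 * Real.pi)) = 0) :
    ∃ c : ℝ → ℂ, ∀ t, _root_.kernelCorr F (𝓕 ψ : 𝓢(ℝ, ℂ)) t
      = ∑ μ ∈ (hfin R).toFinset, c μ * expChar (-μ) t := by
  choose φ hφ1 hφ0 using fun μ => hfin.exists_schwartz μ
  refine ⟨fun μ => ψ (-μ / (2 * Real.pi)) * _root_.kernelCorr F (𝓕 (φ μ) : 𝓢(ℝ, ℂ)) 0, fun t => ?_⟩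
  -- The dependence on t is moved from the correlation into ψ, so that everything is evaluated at 0.
  obtain ⟨χ, hχ, hχF⟩ := exists_schwartz_modulation ψ hcpt t
  rw [kernelCorr_eq_of_shift hχF]
  -- Subtracting the finite interpolant of χ leaves a function vanishing at -μ/(2π) for every μ in
  -- Λ: for |μ| > R both terms vanish there. Uniqueness makes its contribution zero.
  set θ : 𝓢(ℝ, ℂ) := χ - ∑ μ ∈ (hfin R).toFinset, χ (-μ / (2 * Real.pi)) • φ μ with hθ
  have hzero : ∀ μ ∈ Λ, θ (-μ / (2 * Real.pi)) = 0 := by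
    intro μ hμ
    rw [hθ, sub_apply, sum_apply, sub_eq_zero]
    simp only [smul_apply, smul_eq_mul]
    by_cases hR : |μ| ≤ R
    · have hmem : μ ∈ (hfin R).toFinset := by
        rw [Set.Finite.mem_toFinset]
        exact ⟨hμ, abs_le.1 hR⟩
      rw [Finset.sum_eq_single_of_mem μ hmem fun ν _ hne => by rw [hφ0 ν μ hμ hne.symm, mul_zero],
        hφ1, mul_one]
    · have hχ0 : χ (-μ / (2 * Real.pi)) = 0 := by rw [hχ, hψ μ (not_le.1 hR), mul_zero]
      rw [hχ0]
      refine (Finset.sum_eq_zero fun ν hν => ?_).symm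
      rw [Set.Finite.mem_toFinset] at hν
      rw [hφ0 ν μ hμ, mul_zero]
      rintro rfl
      exact hR (abs_le.2 hν.2)
  have h0 := hF.kernelCorr_fourier_eq_zero hΛ θ hzero 0
  have hχθ : χ = θ + ∑ μ ∈ (hfin R).toFinset, χ (-μ / (2 * Real.pi)) • φ μ := by
    rw [hθ, sub_add_cancel]
  have hi : ∀ κ : 𝓢(ℝ, ℂ), Integrable fun u => F (0 + u) * (𝓕 κ : 𝓢(ℝ, ℂ)) u := fun κ =>
    integrable_kernelCorr hF.continuous hF.norm_le (𝓕 κ : 𝓢(ℝ, ℂ)).integrable 0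
  have hlin : _root_.kernelCorr F (𝓕 χ : 𝓢(ℝ, ℂ)) 0 = _root_.kernelCorr F (𝓕 θ : 𝓢(ℝ, ℂ)) 0
      + ∑ μ ∈ (hfin R).toFinset, χ (-μ / (2 * Real.pi)) * _root_.kernelCorr F (𝓕 (φ μ) : 𝓢(ℝ, ℂ)) 0 := by
    have hF1 : 𝓕 χ = 𝓕 θ + ∑ μ ∈ (hfin R).toFinset, χ (-μ / (2 * Real.pi)) • 𝓕 (φ μ) := by
      have := congrArg (fourierCLM ℂ 𝓢(ℝ, ℂ)) hχθ
      rw [map_add, map_sum] at this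
      simpa using this
    simp only [_root_.kernelCorr]
    rw [hF1]
    simp only [add_apply, sum_apply, smul_apply, smul_eq_mul,
      mul_add, Finset.mul_sum]
    rw [integral_add (hi θ), integral_finsetSum]
    · congr 1
      refine Finset.sum_congr rfl fun μ _ => ?_
      rw [← integral_const_mul]
      congr 1
      ext u
      ring
    · intro μ _
      refine ((hi (φ μ)).const_mul (χ (-μ / (2 * Real.pi)))).congr (ae_of_all _ fun u => ?_)
      simp only
      ring
    · refine integrable_finsetSum _ fun μ _ => ?_
      refine ((hi (φ μ)).const_mul (χ (-μ / (2 * Real.pi)))).congr (ae_of_all _ fun u => ?_)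
      simp only
      ring
  rw [hlin, h0, zero_add]
  refine Finset.sum_congr rfl fun μ _ => ?_
  rw [hχ, show expChar (2 * Real.pi * t) (-μ / (2 * Real.pi)) = expChar (-μ) t by
    rw [expChar, expChar]
    congr 3
    field_simp]
  ring

/-- Approximate identities whose transforms are compactly supported. -/
lemma exists_bandlimited_kernel {η : ℝ} (hη : 0 < η) :
    ∃ ψ : 𝓢(ℝ, ℂ), HasCompactSupport ψ ∧ ∫ u, 𝓕 ψ u = 1 ∧ ∫ u, |u| * ‖𝓕 ψ u‖ ≤ η := by
  obtain ⟨f, -, h2, h3, -, h5⟩ := exists_contDiff_tsupport_subset (E := ℝ) (n := ⊤)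
    (x := 0) univ_mem
  have h2' : HasCompactSupport fun v => (f v : ℂ) := h2.comp_left (g := Complex.ofReal) rfl
  have h3' : ContDiff ℝ ∞ fun v => (f v : ℂ) := Complex.ofRealCLM.contDiff.comp h3
  set ψ := h2'.toSchwartzMap h3'
  set I := ∫ u, |u| * ‖𝓕 ψ u‖
  have hI : 0 ≤ I := integral_nonneg fun u => by positivity
  -- Dilating ψ by x divides the first moment of its transform by x, and I / x ≤ η; the +1 keeps x
  -- positive.
  set x := I / η + 1 with hx
  have hx0 : 0 < x := by positivity
  have hcx : HasCompactSupport fun v => ψ (v / x) := by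
    have : HasCompactSupport ψ := h2'
    have := this.comp_homeomorph (Homeomorph.mulRight₀ x⁻¹ (by positivity))
    simpa [Function.comp_def, div_eq_mul_inv] using this
  set ψx := hcx.toSchwartzMap ((ψ.smooth ⊤).comp (contDiff_id.div_const x))
  have hFx : ∀ u, 𝓕 ψx u = x * 𝓕 ψ (x * u) := by
    intro u
    rw [SchwartzMap.fourier_coe, SchwartzMap.fourier_coe, Real.fourier_eq', Real.fourier_eq']
    have := Measure.integral_comp_div (fun v : ℝ =>
      Complex.exp (↑(-2 * Real.pi * inner ℝ v (x * u)) * Complex.I) • ψ v) x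
    rw [abs_of_pos hx0, Complex.real_smul] at this
    rw [← this]
    congr 1
    ext v
    simp only [ψx, HasCompactSupport.toSchwartzMap_toFun]
    congr 4
    simp only [RCLike.inner_apply, conj_trivial]
    field_simp
  refine ⟨ψx, hcx, ?_, ?_⟩
  · have := integral_expChar_mul_fourier ψx 0
    have hval : ψx (0 / (2 * Real.pi)) = 1 := by
      have h0 : ψx (0 / (2 * Real.pi)) = f (0 / (2 * Real.pi) / x) := rfl
      rw [h0, zero_div, zero_div, h5, Complex.ofReal_one]
    rw [hval] at this
    simpa [expChar] using this
  · have := Measure.integral_comp_mul_left (fun u => |u| * ‖𝓕 ψ u‖) x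
    rw [abs_of_pos (inv_pos.2 hx0), smul_eq_mul] at this
    have h : ∫ u, |u| * ‖𝓕 ψx u‖ = x⁻¹ * I := by
      rw [← this]
      congr 1
      ext u
      rw [hFx, norm_mul, Complex.norm_real, Real.norm_of_nonneg hx0.le, abs_mul, abs_of_pos hx0]
      ring
    rw [h, inv_mul_le_iff₀ hx0, hx]
    have : I / η * η = I := by field_simp
    linarith

end Schwartz

/-! ### Total boundedness and common subsequences -/

section Compactness

open MeasureTheory SchwartzMap FourierTransform BoundedContinuousFunction

/-- Almost periodic functions bounded by `B`, with Lipschitz constant `L` and spectrum in `Λ`. -/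
def apClass (B L : ℝ) (Λ : Set ℝ) : Set (ℝ →ᵇ ℂ) :=
  {f | IsAPOnReal B f ∧ (∀ s t, ‖f s - f t‖ ≤ L * |s - t|) ∧ ∀ μ ∉ Λ, HasZeroMean f μ}

/-- A character as a bounded continuous function. -/
noncomputable def expCharBCF (μ : ℝ) : ℝ →ᵇ ℂ :=
  BoundedContinuousFunction.ofNormedAddCommGroup (expChar μ) (continuous_expChar μ) 1
    fun t => (norm_expChar μ t).le

lemma totallyBounded_of_approx {α : Type*} [PseudoMetricSpace α] {S : Set α}
    (h : ∀ ε > 0, ∃ K : Set α, TotallyBounded K ∧ ∀ f ∈ S, ∃ P ∈ K, dist f P ≤ ε) :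
    TotallyBounded S := by
  refine Metric.totallyBounded_iff.2 fun ε hε => ?_
  obtain ⟨K, hK, hSK⟩ := h (ε / 2) (by positivity)
  obtain ⟨t, ht, hcov⟩ := Metric.totallyBounded_iff.1 hK (ε / 2) (by positivity)
  refine ⟨t, ht, fun f hf => ?_⟩
  obtain ⟨P, hP, hd⟩ := hSK f hf
  obtain ⟨y, hy, hPy⟩ := Set.mem_iUnion₂.1 (hcov hP)
  refine Set.mem_iUnion₂.2 ⟨y, hy, ?_⟩
  rw [Metric.mem_ball] at hPy ⊢
  linarith [dist_triangle f P y]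

/-- The kernel depends only on ε and L, so a single finite-dimensional space of trigonometric
polynomials approximates the whole class to within ε. -/
theorem totallyBounded_apClass {B L : ℝ} (hL : 0 ≤ L) {Λ : Set ℝ} (hfin : IsLocallyFiniteSet Λ) :
    TotallyBounded (apClass B L Λ) := by
  refine totallyBounded_of_approx fun ε hε => ?_
  obtain ⟨ψ, hcpt, hone, hη⟩ := exists_bandlimited_kernel (show 0 < ε / (L + 1) by positivity)
  obtain ⟨r, hr⟩ := hcpt.isCompact.isBounded.subset_closedBall (0 : ℝ)
  have hpi := Real.pi_pos
  have hψ : ∀ μ : ℝ, 2 * Real.pi * r < |μ| → ψ (-μ / (2 * Real.pi)) = 0 := by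
    intro μ hμ
    by_contra hne
    have := hr (subset_tsupport _ (Function.mem_support.2 hne))
    rw [mem_closedBall_zero_iff, Real.norm_eq_abs, abs_div, abs_neg,
      abs_of_pos (show 0 < 2 * Real.pi by positivity), div_le_iff₀ (by positivity)] at this
    linarith
  set s := (hfin (2 * Real.pi * r)).toFinset
  set V : Submodule ℂ (ℝ →ᵇ ℂ) := Submodule.span ℂ ((fun μ => expCharBCF (-μ)) '' (s : Set ℝ))
  have : FiniteDimensional ℂ V :=
    FiniteDimensional.span_of_finite ℂ (s.finite_toSet.image _)
  have : ProperSpace V := FiniteDimensional.proper ℂ V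
  refine ⟨(Subtype.val : V → ℝ →ᵇ ℂ) '' Metric.closedBall 0 (B + ε),
    ((isCompact_closedBall _ _).image continuous_subtype_val).totallyBounded, ?_⟩
  rintro f ⟨hf, hLip, hΛ⟩
  obtain ⟨c, hc⟩ := hf.exists_kernelCorr_eq_sum hfin hΛ ψ hcpt hψ
  set P : ℝ →ᵇ ℂ := ∑ μ ∈ s, c μ • expCharBCF (-μ)
  have hPV : P ∈ V := Submodule.sum_mem _ fun μ hμ =>
    Submodule.smul_mem _ _ (Submodule.subset_span ⟨μ, hμ, rfl⟩)
  have hPt : ∀ t, P t = kernelCorr f (𝓕 ψ : 𝓢(ℝ, ℂ)) t := by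
    intro t
    rw [hc, BoundedContinuousFunction.coe_sum, Finset.sum_apply]
    rfl
  have hdist : dist f P ≤ ε := by
    rw [BoundedContinuousFunction.dist_le hε.le]
    intro t
    rw [dist_eq_norm, norm_sub_rev, hPt]
    refine (norm_kernelCorr_sub_self_le hf.continuous hf.norm_le hLip (𝓕 ψ : 𝓢(ℝ, ℂ)).integrable
      (integrable_abs_mul_norm_schwartz _) hone t).trans ?_
    calc L * ∫ u, |u| * ‖𝓕 ψ u‖ ≤ L * (ε / (L + 1)) := by gcongr
      _ ≤ (L + 1) * (ε / (L + 1)) := by gcongr; linarith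
      _ = ε := by field_simp
  refine ⟨P, ⟨⟨P, hPV⟩, ?_, rfl⟩, hdist⟩
  rw [mem_closedBall_zero_iff, Submodule.coe_norm]
  have h1 : ‖f‖ ≤ B := (BoundedContinuousFunction.norm_le hf.nonneg).2 hf.norm_le
  have h2 := norm_le_norm_add_norm_sub f P
  rw [← dist_eq_norm] at h2
  linarith

/-- A sequence of sequences in classes of almost periodic functions has a common subsequence that
converges uniformly. -/
theorem exists_subseq_tendsto_of_mem_apClass {B : ℕ → ℝ} {L : ℕ → ℝ} (hL : ∀ m, 0 ≤ L m)
    {Λ : Set ℝ} (hfin : IsLocallyFiniteSet Λ) (g : ℕ → ℕ → ℝ →ᵇ ℂ)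
    (hg : ∀ n m, g n m ∈ apClass (B m) (L m) Λ) :
    ∃ φ : ℕ → ℕ, StrictMono φ ∧ ∀ m, ∃ G : ℝ →ᵇ ℂ, Tendsto (fun k => g (φ k) m) atTop (𝓝 G) := by
  -- Tychonoff's theorem for a countable product replaces the diagonal argument.
  have hcomp : IsCompact (Set.univ.pi fun m => closure (apClass (B m) (L m) Λ)) :=
    isCompact_univ_pi fun m =>
      (totallyBounded_apClass (hL m) hfin).closure.isCompact_of_isClosed
        isClosed_closure
  obtain ⟨G, -, φ, hφ, hlim⟩ := hcomp.tendsto_subseq (x := g)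
    fun n m _ => subset_closure (hg n m)
  exact ⟨φ, hφ, fun m => ⟨G m, (tendsto_pi_nhds.1 hlim) m⟩⟩

end Compactness

/-! ### Bounded analytic functions on half-planes -/

section HalfPlane

open MeasureTheory

variable {f : ℂ → ℂ} {M : ℝ}

lemma isOpen_rightHalfPlane (κ : ℝ) : IsOpen (rightHalfPlane κ) :=
  isOpen_lt continuous_const Complex.continuous_re

lemma rightHalfPlane_subset {κ κ' : ℝ} (h : κ ≤ κ') : rightHalfPlane κ' ⊆ rightHalfPlane κ :=
  fun _ hs => h.trans_lt hs

lemma add_I_mul_mem_rightHalfPlane {κ : ℝ} {s : ℂ} (hs : s ∈ rightHalfPlane κ) (τ : ℝ) :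
    s + Complex.I * τ ∈ rightHalfPlane κ := by
  simpa [rightHalfPlane] using hs

/-- Cauchy's estimate: bounded analytic functions are Lipschitz on smaller half-planes. -/
lemma norm_sub_le_of_bounded_rightHalfPlane (hd : DifferentiableOn ℂ f (rightHalfPlane 0))
    (hM : ∀ s ∈ rightHalfPlane 0, ‖f s‖ ≤ M) {κ : ℝ} (hκ : 0 < κ) {z w : ℂ}
    (hz : z ∈ rightHalfPlane κ) (hw : w ∈ rightHalfPlane κ) :
    ‖f z - f w‖ ≤ M / (κ / 2) * ‖z - w‖ := by
  have hsub : rightHalfPlane κ ⊆ rightHalfPlane 0 := rightHalfPlane_subset hκ.le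
  refine Convex.norm_image_sub_le_of_norm_deriv_le (s := rightHalfPlane κ) (fun x hx =>
    hd.differentiableAt ((isOpen_rightHalfPlane 0).mem_nhds (hsub hx))) (fun x hx => ?_)
    (convex_halfSpace_re_gt κ) hw hz
  have hball : Metric.closedBall x (κ / 2) ⊆ rightHalfPlane 0 := by
    intro y hy
    have h1 : |(y - x).re| ≤ κ / 2 :=
      (Complex.abs_re_le_norm _).trans (by rwa [← mem_closedBall_iff_norm])
    have h2 : κ < x.re := hx
    rw [Complex.sub_re] at h1
    change 0 < y.re
    linarith [(abs_le.1 h1).1]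
  refine Complex.norm_deriv_le_of_forall_mem_sphere_norm_le (by positivity)
    (DifferentiableOn.diffContOnCl (hd.mono ?_)) fun y hy =>
      hM y (hball (Metric.sphere_subset_closedBall hy))
  rwa [closure_ball x (by positivity)]

lemma uniformContinuousOn_of_bounded_rightHalfPlane
    (hd : DifferentiableOn ℂ f (rightHalfPlane 0))
    (hM : ∀ s ∈ rightHalfPlane 0, ‖f s‖ ≤ M) {κ : ℝ} (hκ : 0 < κ) :
    UniformContinuousOn f (rightHalfPlane κ) := by
  refine LipschitzOnWith.uniformContinuousOn (K := (M / (κ / 2)).toNNReal) ?_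
  refine LipschitzOnWith.of_dist_le_mul fun z hz w hw => ?_
  rw [dist_eq_norm, dist_eq_norm]
  refine (norm_sub_le_of_bounded_rightHalfPlane hd hM hκ hz hw).trans ?_
  exact mul_le_mul_of_nonneg_right (Real.le_coe_toNNReal _) (norm_nonneg _)

/-- Almost periodicity on one half-plane propagates to every smaller one. -/
lemma IsAlmostPeriodicOn.of_bounded (hd : DifferentiableOn ℂ f (rightHalfPlane 0))
    (hM : ∀ s ∈ rightHalfPlane 0, ‖f s‖ ≤ M) {κ' : ℝ} (hκ' : 0 < κ')
    (hf : IsAlmostPeriodicOn κ' f) {κ : ℝ} (hκ : 0 < κ) : IsAlmostPeriodicOn κ f := by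
  refine ⟨⟨M, fun s hs => hM s (rightHalfPlane_subset hκ.le hs)⟩,
    uniformContinuousOn_of_bounded_rightHalfPlane hd hM hκ, fun ε hε => ?_⟩
  have hM0 : 0 ≤ M := (norm_nonneg _).trans (hM 1 (by simp [rightHalfPlane]))
  set a := 2 * M + 1
  have ha : 0 < a := by positivity
  -- On the left edge l of the strip only boundedness is available; the right edge u > κ' lies where
  -- τ is a translation number.
  set l := κ / 2
  set u := κ' + κ
  have hlu : l < u := by simp only [l, u]; linarith
  -- The interpolation weight at Re s = κ, the least one that occurs. With it, δ is chosen so that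
  -- a^{1-θ} δ^θ ≤ ε for all θ ≥ θ₀; q ≤ 1 gives the monotonicity in θ.
  set θ₀ := (κ - l) / (u - l)
  have hθ₀ : 0 < θ₀ := div_pos (by simp only [l]; linarith) (by linarith)
  set q := min 1 (ε / a)
  have hq0 : 0 < q := lt_min one_pos (by positivity)
  set δ := a * q ^ (1 / θ₀)
  have hδ : 0 < δ := by positivity
  obtain ⟨d, hd0, hdense⟩ := hf.relativelyDense (min δ ε) (lt_min hδ hε)
  refine ⟨d, hd0, fun x => (hdense x).mono (Set.inter_subset_inter_right _ fun τ hτ s hs => ?_)⟩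
  by_cases hsκ : κ' < s.re
  · exact (hτ s hsκ).trans (min_le_right _ _)
  set h : ℂ → ℂ := fun z => f (z + Complex.I * τ) - f z
  have hhd : DifferentiableOn ℂ h (rightHalfPlane 0) :=
    (hd.comp (by fun_prop) fun z hz => add_I_mul_mem_rightHalfPlane hz τ).sub hd
  have hha : ∀ z ∈ rightHalfPlane 0, ‖h z‖ ≤ a := by
    intro z hz
    have := norm_sub_le_of_le (hM _ (add_I_mul_mem_rightHalfPlane hz τ)) (hM z hz)
    simp only [a, h]
    linarith
  have hl0 : 0 < l := by simp only [l]; positivity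
  have hstrip : Complex.re ⁻¹' Set.Icc l u ⊆ rightHalfPlane 0 := fun z hz => hl0.trans_le hz.1
  have hs' : κ < s.re := hs
  have key := Complex.HadamardThreeLines.norm_le_interp_of_mem_verticalClosedStrip'
    (f := h) (z := s) (a := a) (b := δ) hlu
    ⟨by simp only [l]; linarith, by simp only [u]; linarith⟩
    (DifferentiableOn.diffContOnCl (hhd.mono (by
      rw [Complex.HadamardThreeLines.verticalStrip, Complex.closure_preimage_re,
        closure_Ioo hlu.ne]
      exact hstrip)))
    ⟨a, by rintro _ ⟨z, hz, rfl⟩; exact hha z (hstrip hz)⟩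
    (fun z hz => hha z (hstrip (by rw [Set.mem_preimage] at hz ⊢; rw [hz]; exact ⟨le_rfl, hlu.le⟩)))
    (fun z hz => (hτ z (by
      rw [Set.mem_preimage] at hz
      change κ' < z.re
      rw [hz]
      simp only [u]; linarith)).trans (min_le_left _ _))
  refine key.trans ?_
  set θ := (s.re - l) / (u - l)
  have hθ : θ₀ ≤ θ := by
    have : 0 < u - l := by linarith
    simp only [θ₀, θ]
    gcongr
  have e1 : a ^ (1 - θ) * δ ^ θ = a * (q ^ (1 / θ₀)) ^ θ := by
    rw [Real.mul_rpow ha.le (by positivity), ← mul_assoc, ← Real.rpow_add ha]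
    simp
  have e2 : (q ^ (1 / θ₀)) ^ θ ≤ q := by
    rw [← Real.rpow_mul hq0.le]
    have : q ^ (1 / θ₀ * θ) ≤ q ^ (1 : ℝ) := by
      refine Real.rpow_le_rpow_of_exponent_ge hq0 (min_le_left _ _) ?_
      rw [one_div, inv_mul_eq_div, one_le_div hθ₀]
      exact hθ
    simpa using this
  rw [e1]
  calc a * (q ^ (1 / θ₀)) ^ θ ≤ a * (ε / a) := by
        gcongr
        exact e2.trans (min_le_right _ _)
    _ = ε := by field_simp

/-- A bound on a vertical line is a bound on the half-plane to the right of it. -/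
lemma norm_le_of_norm_le_on_line (hd : DifferentiableOn ℂ f (rightHalfPlane 0))
    (hM : ∀ s ∈ rightHalfPlane 0, ‖f s‖ ≤ M) {σ C : ℝ} (hσ : 0 < σ)
    (hC : ∀ t : ℝ, ‖f (σ + Complex.I * t)‖ ≤ C) {s : ℂ} (hs : σ ≤ s.re) : ‖f s‖ ≤ C := by
  set g : ℂ → ℂ := fun z => f (z + σ)
  have hmem : ∀ z : ℂ, 0 ≤ z.re → z + σ ∈ rightHalfPlane 0 := by
    intro z hz
    change 0 < (z + σ).re
    rw [Complex.add_re, Complex.ofReal_re]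
    linarith
  have hg : DiffContOnCl ℂ g {z | 0 < z.re} := by
    refine DifferentiableOn.diffContOnCl ?_
    rw [Complex.closure_setOfPred_lt_re]
    exact hd.comp (by fun_prop) fun z hz => hmem z hz
  -- With growth exponent 1 and constant 0 the growth condition is mere boundedness.
  have := PhragmenLindelof.right_half_plane_of_bounded_on_real (f := g) (C := C) (z := s - σ) hg
    ⟨1, by norm_num, 0, ?_⟩ ?_ ?_ (by simpa using hs)
  · simpa [g] using this
  · refine Asymptotics.IsBigO.of_bound M ?_
    filter_upwards [mem_inf_of_right (mem_principal_self _)] with z hz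
    simpa using hM _ (hmem z (le_of_lt hz))
  · refine ⟨M, ?_⟩
    rw [eventually_map]
    filter_upwards [eventually_ge_atTop 0] with x hx
    exact hM _ (hmem x (by simpa using hx))
  · intro x
    have := hC x
    rwa [add_comm, mul_comm] at this

end HalfPlane

/-! ### Restriction to vertical lines and Bohr coefficients -/

section Line

open MeasureTheory

variable {f : ℂ → ℂ} {M : ℝ}

/-- The restriction of `f` to the vertical line `Re s = σ`. -/
noncomputable def onLine (f : ℂ → ℂ) (σ t : ℝ) : ℂ := f (σ + Complex.I * t)

lemma line_mem_rightHalfPlane {κ σ : ℝ} (h : κ < σ) (t : ℝ) :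
    (σ + Complex.I * t : ℂ) ∈ rightHalfPlane κ := by
  simpa [rightHalfPlane] using h

lemma norm_onLine_sub_le (hd : DifferentiableOn ℂ f (rightHalfPlane 0))
    (hM : ∀ s ∈ rightHalfPlane 0, ‖f s‖ ≤ M) {σ : ℝ} (hσ : 0 < σ) (s t : ℝ) :
    ‖onLine f σ s - onLine f σ t‖ ≤ M / (σ / 2 / 2) * |s - t| := by
  -- The line lies on the boundary of ℂ_σ, so the estimate is taken on ℂ_{σ/2}; hence the second
  -- halving.
  have h := norm_sub_le_of_bounded_rightHalfPlane hd hM (half_pos hσ)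
    (line_mem_rightHalfPlane (half_lt_self hσ) s) (line_mem_rightHalfPlane (half_lt_self hσ) t)
  rwa [add_sub_add_left_eq_sub, ← mul_sub, norm_mul, Complex.norm_I, one_mul,
    ← Complex.ofReal_sub, Complex.norm_real, Real.norm_eq_abs] at h

lemma uniformContinuous_onLine (hd : DifferentiableOn ℂ f (rightHalfPlane 0))
    (hM : ∀ s ∈ rightHalfPlane 0, ‖f s‖ ≤ M) {σ : ℝ} (hσ : 0 < σ) :
    UniformContinuous (onLine f σ) := by
  refine LipschitzWith.uniformContinuous (K := (M / (σ / 2 / 2)).toNNReal) ?_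
  refine LipschitzWith.of_dist_le_mul fun s t => ?_
  rw [dist_eq_norm, Real.dist_eq]
  exact (norm_onLine_sub_le hd hM hσ s t).trans
    (mul_le_mul_of_nonneg_right (Real.le_coe_toNNReal _) (abs_nonneg _))

lemma isAPOnReal_onLine (hd : DifferentiableOn ℂ f (rightHalfPlane 0))
    (hM : ∀ s ∈ rightHalfPlane 0, ‖f s‖ ≤ M) {κ : ℝ} (hκ : 0 < κ)
    (hf : IsAlmostPeriodicOn κ f) {σ : ℝ} (hσ : 0 < σ) : IsAPOnReal M (onLine f σ) := by
  refine ⟨fun t => hM _ (line_mem_rightHalfPlane hσ t), uniformContinuous_onLine hd hM hσ,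
    fun ε hε => ?_⟩
  obtain ⟨d, hd0, h⟩ := (hf.of_bounded hd hM hκ (half_pos hσ)).relativelyDense ε hε
  refine ⟨d, hd0, fun a => (h a).mono (Set.inter_subset_inter_right _ fun τ hτ t => ?_)⟩
  have := hτ _ (line_mem_rightHalfPlane (half_lt_self hσ) t)
  rwa [add_assoc, ← mul_add, ← Complex.ofReal_add] at this

lemma bohrMean_eq (f : ℂ → ℂ) (μ σ T : ℝ) :
    bohrMean f μ σ T = Complex.exp (μ * σ) *
      ((1 / (2 * (T : ℂ))) * ∫ t in (-T)..T, onLine f σ t * expChar μ t) := by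
  have h : ∀ t : ℝ, f (σ + Complex.I * t) * Complex.exp (μ * (σ + Complex.I * t))
      = Complex.exp (μ * σ) * (onLine f σ t * expChar μ t) := by
    intro t
    rw [onLine, expChar, mul_left_comm, ← Complex.exp_add]
    congr 2
    push_cast
    ring
  simp only [bohrMean, h]
  rw [intervalIntegral.integral_const_mul, mul_left_comm]

lemma tendsto_bohrMean_zero_iff {f : ℂ → ℂ} {μ σ : ℝ} :
    Tendsto (bohrMean f μ σ) atTop (𝓝 0) ↔ HasZeroMean (onLine f σ) μ := by
  rw [funext (bohrMean_eq f μ σ), HasZeroMean]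
  constructor
  · intro h
    have := h.const_mul (Complex.exp (μ * σ))⁻¹
    simpa only [inv_mul_cancel_left₀ (Complex.exp_ne_zero _), mul_zero] using this
  · intro h
    have := h.const_mul (Complex.exp (μ * σ))
    rwa [mul_zero] at this

lemma norm_bohrMean_le {f : ℂ → ℂ} {μ σ C T : ℝ} (hT : 0 < T)
    (hC : ∀ t : ℝ, ‖f (σ + Complex.I * t) * Complex.exp (μ * (σ + Complex.I * t))‖ ≤ C) :
    ‖bohrMean f μ σ T‖ ≤ C := by
  have h := norm_intervalIntegral_le hC (-T) T
  rw [bohrMean, norm_mul, norm_div, norm_mul, Complex.norm_real, Real.norm_of_nonneg hT.le]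
  rw [show T - -T = 2 * T by ring, abs_of_pos (by positivity)] at h
  rw [norm_one, RCLike.norm_two, one_div, inv_mul_le_iff₀ (by positivity)]
  linarith

/-- Bounded analytic functions have no negative frequencies. -/
lemma hasZeroMean_onLine_of_neg (hd : DifferentiableOn ℂ f (rightHalfPlane 0))
    (hM : ∀ s ∈ rightHalfPlane 0, ‖f s‖ ≤ M) {σ : ℝ} (hσ : 0 < σ) {μ : ℝ} (hμ : μ < 0) :
    HasZeroMean (onLine f σ) μ := by
  have hM0 : 0 ≤ M := (norm_nonneg _).trans (hM 1 (by simp [rightHalfPlane]))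
  rw [← tendsto_bohrMean_zero_iff]
  set h : ℂ → ℂ := fun s => f s * Complex.exp (μ * s)
  have hhd : DifferentiableOn ℂ h (rightHalfPlane 0) := hd.mul (by fun_prop)
  have hh : ∀ s ∈ rightHalfPlane 0, ‖h s‖ ≤ M * Real.exp (μ * s.re) := by
    intro s hs
    rw [norm_mul, Complex.norm_exp, Complex.re_ofReal_mul]
    exact mul_le_mul_of_nonneg_right (hM s hs) (Real.exp_pos _).le
  have hhM : ∀ s ∈ rightHalfPlane 0, ‖h s‖ ≤ M := by
    intro s hs
    refine (hh s hs).trans (mul_le_of_le_one_right hM0 (Real.exp_le_one_iff.2 ?_))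
    exact mul_nonpos_of_nonpos_of_nonneg hμ.le (le_of_lt hs)
  rw [Metric.tendsto_atTop']
  intro ε hε
  have hlim : Tendsto (fun σ' : ℝ => M * Real.exp (μ * σ')) atTop (𝓝 0) := by
    have := (Real.tendsto_exp_atBot.comp
      (tendsto_id.const_mul_atTop_of_neg hμ)).const_mul M
    simpa using this
  -- Far to the right e^{μσ'} makes the mean small. By Cauchy's theorem on a rectangle the means at
  -- σ and σ' differ by O(1/T), as the horizontal sides have fixed length.
  obtain ⟨σ', hσ'ε, hσσ'⟩ := ((hlim.eventually_lt_const (half_pos hε)).and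
    (eventually_ge_atTop σ)).exists
  refine ⟨max 0 (M * (σ' - σ) / (ε / 2)), fun T hT => ?_⟩
  have hT0 : 0 < T := (le_max_left _ _).trans_lt hT
  have hT1 : M * (σ' - σ) < T * (ε / 2) := by
    rw [← div_lt_iff₀ (half_pos hε)]
    exact (le_max_right _ _).trans_lt hT
  have hσ'0 : 0 < σ' := hσ.trans_le hσσ'
  have hrect := Complex.integral_boundary_rect_eq_zero_of_differentiableOn h
    (⟨σ, -T⟩ : ℂ) (⟨σ', T⟩ : ℂ) (hhd.mono fun z hz => by
      have := hz.1
      simp only [Set.mem_preimage, Set.uIcc_of_le hσσ'] at this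
      exact hσ.trans_le this.1)
  simp only [smul_eq_mul] at hrect
  have hline : ∀ ρ : ℝ, (1 / (2 * (T : ℂ))) * ∫ y in (-T)..T, h (ρ + y * Complex.I)
      = bohrMean f μ ρ T := by
    intro ρ
    rw [bohrMean]
    simp only [h, mul_comm Complex.I]
  have hhor : ∀ y : ℝ, ‖∫ x in σ..σ', h (x + y * Complex.I)‖ ≤ M * (σ' - σ) := by
    intro y
    have := intervalIntegral.norm_integral_le_of_norm_le_const (a := σ) (b := σ') (C := M)
      (f := fun x : ℝ => h (x + y * Complex.I)) fun x hx => by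
        rw [Set.uIoc_of_le hσσ'] at hx
        refine hhM _ ?_
        simpa [rightHalfPlane] using hσ.trans hx.1
    rwa [abs_of_nonneg (by linarith)] at this
  have hdiff : ‖bohrMean f μ σ T - bohrMean f μ σ' T‖ ≤ M * (σ' - σ) / T := by
    rw [← hline, ← hline, ← mul_sub]
    set X := ∫ y in (-T)..T, h (σ + y * Complex.I)
    set Y := ∫ y in (-T)..T, h (σ' + y * Complex.I)
    have e : ‖X - Y‖ = ‖Complex.I * (X - Y)‖ := by rw [norm_mul, Complex.norm_I, one_mul]
    have e2 : Complex.I * (X - Y) = (∫ x in σ..σ', h (x + (-T : ℝ) * Complex.I))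
        - ∫ x in σ..σ', h (x + T * Complex.I) := by
      linear_combination -hrect
    have e3 : ‖X - Y‖ ≤ M * (σ' - σ) + M * (σ' - σ) := by
      rw [e, e2]
      exact norm_sub_le_of_le (hhor _) (hhor _)
    rw [norm_mul, norm_div, norm_mul, Complex.norm_real, Real.norm_of_nonneg hT0.le, norm_one,
      RCLike.norm_two]
    calc 1 / (2 * T) * ‖X - Y‖ ≤ 1 / (2 * T) * (M * (σ' - σ) + M * (σ' - σ)) := by gcongr
      _ = M * (σ' - σ) / T := by field_simp; ring
  have hfar : ‖bohrMean f μ σ' T‖ ≤ M * Real.exp (μ * σ') := by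
    refine norm_bohrMean_le hT0 fun t => ?_
    have := hh _ (line_mem_rightHalfPlane hσ'0 t)
    simpa [h] using this
  have hsmall : M * (σ' - σ) / T < ε / 2 := by
    rw [div_lt_iff₀ hT0]
    linarith
  rw [dist_zero_right]
  have := norm_le_norm_add_norm_sub' (bohrMean f μ σ T) (bohrMean f μ σ' T)
  linarith

lemma hasZeroMean_onLine_of_notMem {lam : ℕ → ℝ} (hf : f ∈ HInftyFreq lam)
    {σ : ℝ} (hσ : 0 < σ) {μ : ℝ} (hμ : μ ∉ Set.range lam) : HasZeroMean (onLine f σ) μ := by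
  obtain ⟨⟨⟨hd, M, hM⟩, -⟩, hspec⟩ := hf
  rcases lt_or_ge μ 0 with h | h
  · exact hasZeroMean_onLine_of_neg hd hM hσ h
  · have : HasBohrCoeff f μ 0 := by
      by_contra hne
      exact hμ (hspec ⟨h, hne⟩)
    exact tendsto_bohrMean_zero_iff.1 (this σ hσ)

lemma HasZeroMean.of_uniform_approx {F : ℝ → ℂ} (hF : Continuous F) {μ : ℝ}
    (h : ∀ ε > 0, ∃ g : ℝ → ℂ, Continuous g ∧ HasZeroMean g μ ∧ ∀ t, ‖F t - g t‖ ≤ ε) :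
    HasZeroMean F μ := by
  rw [HasZeroMean, Metric.tendsto_nhds]
  intro ε hε
  obtain ⟨g, hgc, hg, hFg⟩ := h (ε / 2) (half_pos hε)
  filter_upwards [(Metric.tendsto_nhds.1 hg) (ε / 2) (half_pos hε), eventually_gt_atTop 0]
    with T h1 hT
  rw [dist_zero_right] at h1 ⊢
  have h2 := norm_integral_mul_expChar_sub_le hF hgc hFg μ (-T) T
  rw [show T - -T = 2 * T by ring, abs_of_pos (by positivity)] at h2
  have h3 : ‖(1 / (2 * (T : ℂ))) * (∫ t in (-T)..T, F t * expChar μ t)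
      - (1 / (2 * (T : ℂ))) * ∫ t in (-T)..T, g t * expChar μ t‖ ≤ ε / 2 := by
    rw [← mul_sub, norm_mul, norm_div, norm_mul, Complex.norm_real, Real.norm_of_nonneg hT.le,
      norm_one, RCLike.norm_two, one_div, inv_mul_le_iff₀ (by positivity)]
    linarith
  have := norm_le_norm_add_norm_sub' ((1 / (2 * (T : ℂ))) * ∫ t in (-T)..T, F t * expChar μ t)
    ((1 / (2 * (T : ℂ))) * ∫ t in (-T)..T, g t * expChar μ t)
  linarith

end Line

/-! ### Closedness under limits and the compactness theorem -/

lemma IsFrequency.isLocallyFiniteSet {lam : ℕ → ℝ} (hlam : IsFrequency lam) :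
    IsLocallyFiniteSet (Set.range lam) := by
  intro R
  obtain ⟨N, hN⟩ := eventually_atTop.1 (hlam.tendsto.eventually_gt_atTop R)
  refine ((Set.finite_Iio N).image lam).subset ?_
  rintro _ ⟨⟨n, rfl⟩, hn⟩
  exact ⟨n, not_le.1 fun h => (hN n h).not_ge hn.2, rfl⟩

/-- Translation numbers and vanishing means both survive uniform approximation. The half-plane of
almost periodicity may vary with n, so `IsAlmostPeriodicOn.of_bounded` first brings every
approximant to ℂ_1. -/
lemma mem_HInftyFreq_of_tendstoUniformlyOn {lam : ℕ → ℝ} {v : ℕ → ℂ → ℂ} {f : ℂ → ℂ} {M : ℝ}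
    (hv : ∀ n, v n ∈ HInftyFreq lam) (hM : ∀ n, ∀ s ∈ rightHalfPlane 0, ‖v n s‖ ≤ M)
    (hlim : ∀ κ : ℝ, 0 < κ → TendstoUniformlyOn v f atTop (rightHalfPlane κ)) :
    f ∈ HInftyFreq lam := by
  have hvd : ∀ n, DifferentiableOn ℂ (v n) (rightHalfPlane 0) := fun n => (hv n).1.1.1
  have hmem : ∀ s ∈ rightHalfPlane 0, s ∈ rightHalfPlane (s.re / 2) := fun s hs =>
    half_lt_self (show 0 < s.re from hs)
  have hd : DifferentiableOn ℂ f (rightHalfPlane 0) := by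
    intro s hs
    have hs' : 0 < s.re := hs
    have h1 := (hlim (s.re / 2) (half_pos hs')).tendstoLocallyUniformlyOn.differentiableOn
      (Eventually.of_forall fun n =>
        (hvd n).mono (rightHalfPlane_subset (half_pos hs').le)) (isOpen_rightHalfPlane _)
    exact (h1.differentiableAt
      ((isOpen_rightHalfPlane _).mem_nhds (hmem s hs))).differentiableWithinAt
  have hfM : ∀ s ∈ rightHalfPlane 0, ‖f s‖ ≤ M := by
    intro s hs
    exact le_of_tendsto (((hlim (s.re / 2) (half_pos (show 0 < s.re from hs))).tendsto_at
      (hmem s hs)).norm) (Eventually.of_forall fun n => hM n s hs)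
  have hclose : ∀ κ > 0, ∀ ε > 0, ∃ n, ∀ s ∈ rightHalfPlane κ, ‖f s - v n s‖ ≤ ε := by
    intro κ hκ ε hε
    obtain ⟨n, hn⟩ := (Metric.tendstoUniformlyOn_iff.1 (hlim κ hκ) ε hε).exists
    exact ⟨n, fun s hs => by rw [← dist_eq_norm]; exact (hn s hs).le⟩
  refine ⟨⟨⟨hd, M, hfM⟩, 1, one_pos, ?_⟩, ?_⟩
  · refine ⟨⟨M, fun s hs => hfM s (rightHalfPlane_subset zero_le_one hs)⟩,
      uniformContinuousOn_of_bounded_rightHalfPlane hd hfM one_pos, fun ε hε => ?_⟩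
    obtain ⟨n, hn⟩ := hclose 1 one_pos (ε / 3) (by positivity)
    obtain ⟨κ, hκ, hap⟩ := (hv n).1.2
    obtain ⟨d, hd0, hdense⟩ := (hap.of_bounded (hvd n) (hM n) hκ one_pos).relativelyDense (ε / 3)
      (by positivity)
    refine ⟨d, hd0, fun a => (hdense a).mono (Set.inter_subset_inter_right _ fun τ hτ s hs => ?_)⟩
    have h1 := hn _ (add_I_mul_mem_rightHalfPlane hs τ)
    have h2 := hn s hs
    have h3 := hτ s hs
    rw [norm_sub_rev] at h2
    calc ‖f (s + Complex.I * τ) - f s‖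
        = ‖(f (s + Complex.I * τ) - v n (s + Complex.I * τ))
            + (v n (s + Complex.I * τ) - v n s) + (v n s - f s)‖ := by ring_nf
      _ ≤ ε / 3 + ε / 3 + ε / 3 := norm_add_le_of_le (norm_add_le_of_le h1 h3) h2
      _ = ε := by ring
  · rintro μ ⟨-, hne⟩
    by_contra hμ
    refine hne fun σ hσ => tendsto_bohrMean_zero_iff.2 ?_
    refine HasZeroMean.of_uniform_approx (uniformContinuous_onLine hd hfM hσ).continuous
      fun ε hε => ?_
    obtain ⟨n, hn⟩ := hclose (σ / 2) (half_pos hσ) ε hε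
    exact ⟨onLine (v n) σ, (uniformContinuous_onLine (hvd n) (hM n) hσ).continuous,
      hasZeroMean_onLine_of_notMem (hv n) hσ hμ,
      fun t => hn _ (line_mem_rightHalfPlane (half_lt_self hσ) t)⟩

theorem mainTheorem6 (lam : ℕ → ℝ) (hlam : IsFrequency lam)
    (F : Set (ℂ → ℂ)) (hF : F ⊆ HInftyFreq lam)
    (hbdd : ∃ M : ℝ, ∀ f ∈ F, ∀ s ∈ rightHalfPlane 0, ‖f s‖ ≤ M)
    (u : ℕ → ℂ → ℂ) (hu : ∀ n, u n ∈ F) :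
    ∃ f ∈ HInftyFreq lam, ∃ φ : ℕ → ℕ, StrictMono φ ∧
      ∀ κ : ℝ, 0 < κ →
        TendstoUniformlyOn (fun k => u (φ k)) f atTop (rightHalfPlane κ) := by
  obtain ⟨M, hFM⟩ := hbdd
  have hM : ∀ n, ∀ s ∈ rightHalfPlane 0, ‖u n s‖ ≤ M := fun n => hFM _ (hu n)
  have hM0 : 0 ≤ M := (norm_nonneg _).trans (hM 0 1 (by simp [rightHalfPlane]))
  have hmem : ∀ n, u n ∈ HInftyFreq lam := fun n => hF (hu n)
  have hd : ∀ n, DifferentiableOn ℂ (u n) (rightHalfPlane 0) := fun n => (hmem n).1.1.1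
  have hσ : ∀ m : ℕ, (0 : ℝ) < 1 / (m + 1) := fun m => Nat.one_div_pos_of_nat
  set g : ℕ → ℕ → BoundedContinuousFunction ℝ ℂ := fun n m =>
    BoundedContinuousFunction.ofNormedAddCommGroup (onLine (u n) (1 / ((m : ℝ) + 1)))
      (uniformContinuous_onLine (hd n) (hM n) (hσ m)).continuous M
      fun t => hM n _ (line_mem_rightHalfPlane (hσ m) t)
  have hg : ∀ n (m : ℕ), g n m ∈ apClass M (M / (1 / ((m : ℝ) + 1) / 2 / 2)) (Set.range lam) := by
    intro n m
    obtain ⟨κ, hκ, hap⟩ := (hmem n).1.2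
    exact ⟨isAPOnReal_onLine (hd n) (hM n) hκ hap (hσ m), norm_onLine_sub_le (hd n) (hM n) (hσ m),
      fun μ hμ => hasZeroMean_onLine_of_notMem (hmem n) (hσ m) hμ⟩
  obtain ⟨φ, hφ, hlim⟩ := exists_subseq_tendsto_of_mem_apClass (B := fun _ => M)
    (fun m => by have := hσ m; positivity) hlam.isLocallyFiniteSet g hg
  have hcauchy : ∀ κ : ℝ, 0 < κ →
      UniformCauchySeqOn (fun k => u (φ k)) atTop (rightHalfPlane κ) := by
    intro κ hκ
    -- A line to the left of ℂ_κ, on which the subsequence is already uniformly Cauchy.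
    obtain ⟨m, hm⟩ := exists_nat_one_div_lt hκ
    obtain ⟨G, hG⟩ := hlim m
    rw [Metric.uniformCauchySeqOn_iff]
    intro ε hε
    obtain ⟨N, hN⟩ := Metric.cauchySeq_iff.1 hG.cauchySeq (ε / 2) (half_pos hε)
    refine ⟨N, fun j hj k hk s hs => ?_⟩
    rw [dist_eq_norm]
    have hle := norm_le_of_norm_le_on_line (f := fun z => u (φ j) z - u (φ k) z) (M := M + M)
      ((hd _).sub (hd _)) (fun z hz => norm_sub_le_of_le (hM _ z hz) (hM _ z hz)) (hσ m)
      (C := ε / 2) (fun t => ?_) (hm.le.trans (le_of_lt hs))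
    · linarith
    · rw [← dist_eq_norm]
      exact ((g (φ j) m).dist_coe_le_dist t).trans (hN j hj k hk).le
  -- Outside ℂ_0 the limit function takes the irrelevant value 0.
  have hpt : ∀ s : ℂ, ∃ z : ℂ, s ∈ rightHalfPlane 0 →
      Tendsto (fun k => u (φ k) s) atTop (𝓝 z) := by
    intro s
    by_cases hs : s ∈ rightHalfPlane 0
    · have hs' : 0 < s.re := hs
      have hcs : CauchySeq fun k => u (φ k) s :=
        (hcauchy (s.re / 2) (half_pos hs')).cauchySeq (half_lt_self hs')
      obtain ⟨z, hz⟩ := cauchySeq_tendsto_of_complete hcs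
      exact ⟨z, fun _ => hz⟩
    · exact ⟨0, fun h => absurd h hs⟩
  choose f hf using hpt
  have hunif : ∀ κ : ℝ, 0 < κ →
      TendstoUniformlyOn (fun k => u (φ k)) f atTop (rightHalfPlane κ) := fun κ hκ =>
    (hcauchy κ hκ).tendstoUniformlyOn_of_tendsto fun s hs => hf s (rightHalfPlane_subset hκ.le hs)
  exact ⟨f, mem_HInftyFreq_of_tendstoUniformlyOn (fun n => hmem (φ n)) (fun n => hM (φ n)) hunif,
    φ, hφ, hunif⟩
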